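/- Let $\Omega\subset\mathbb{R}^2$ be open, let $g_0$ be a smooth flat Riemannian metric on $\Omega$, let $\ell:\Omega\to(0,\infty)$ be a smooth function such that the metric $\ell g_0$ has constant Gauss curvature $-2$, and let $h:\Omega\to\mathbb{R}$ be a smooth function that is harmonic with respect to $g_0$. Let $\bar g=\ell^{-1/2}e^{-h}g_0$ (a leaf-like metric). Then every point $p\in\Omega$ has an open neighbourhood $U\subset\Omega$ for which there exist a nonempty connected open set $M\subset\mathbb{R}^4$, a smooth Kähler structure $(g,J)$ on $M$ with $g$ Ricci-flat, and a smooth foliation of $M$ by two-dimensional totally geodesic leaves, such that every leaf, with the metric induced by $g$, is isometric to $(U,\bar g|_U)$. Moreover, the Lie algebra of Killing fields of $g$ on $M$ has dimension at least $2$. -/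

import Mathlib

open scoped ContDiff

noncomputable section

namespace LeafLike

/-- Coordinate space `ℝⁿ`. Tensor fields on an open subset of `ℝⁿ` are given by their components in
the standard coordinates; only their values on the open set under consideration matter. -/
abbrev Coord (n : ℕ) : Type := Fin n → ℝ

/-- A field of `n × n` matrices on `ℝⁿ`. -/
abbrev MatField (n : ℕ) : Type := Coord n → Matrix (Fin n) (Fin n) ℝ

/-- The partial derivative `∂ᵢ f` at `x`. -/
def pd {m : ℕ} (i : Fin m) (f : Coord m → ℝ) (x : Coord m) : ℝ :=
  fderiv ℝ f x (Pi.single i 1)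

/-- The components of the matrix field are smooth on `U`. -/
def SmoothMatOn {n : ℕ} (A : MatField n) (U : Set (Coord n)) : Prop :=
  ∀ i j, ContDiffOn ℝ ∞ (fun x => A x i j) U

/-! ### Riemannian geometry in coordinates -/

/-- `g` is a smooth Riemannian metric on `U`, with components `gᵢⱼ = g x i j`. -/
structure IsMetricOn {n : ℕ} (g : MatField n) (U : Set (Coord n)) : Prop where
  smooth : SmoothMatOn g U
  posDef : ∀ x ∈ U, (g x).PosDef

/-- The Christoffel symbols
`Γᵏᵢⱼ = ½ ∑ₗ gᵏˡ (∂ᵢ gⱼₗ + ∂ⱼ gᵢₗ - ∂ₗ gᵢⱼ)` of the Levi-Civita connection. -/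
def christoffel {n : ℕ} (g : MatField n) (k i j : Fin n) (x : Coord n) : ℝ :=
  (1 / 2 : ℝ) * ∑ l, (g x)⁻¹ k l *
    (pd i (fun y => g y j l) x + pd j (fun y => g y i l) x - pd l (fun y => g y i j) x)

/-- The component `Rˡₖᵢⱼ` of the Riemann curvature tensor, with the convention
`R(∂ᵢ, ∂ⱼ) ∂ₖ = ∇ᵢ ∇ⱼ ∂ₖ - ∇ⱼ ∇ᵢ ∂ₖ = ∑ₗ Rˡₖᵢⱼ ∂ₗ`. -/
def riemann {n : ℕ} (g : MatField n) (l k i j : Fin n) (x : Coord n) : ℝ :=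
  pd i (christoffel g l j k) x - pd j (christoffel g l i k) x
    + ∑ m, (christoffel g l i m x * christoffel g m j k x
        - christoffel g l j m x * christoffel g m i k x)

/-- The Ricci tensor `Ric(∂ₖ, ∂ⱼ)`, the trace of `X ↦ R(X, ∂ⱼ) ∂ₖ`. -/
def ricci {n : ℕ} (g : MatField n) (k j : Fin n) (x : Coord n) : ℝ :=
  ∑ i, riemann g i k i j x

/-- The Gauss curvature `⟨R(∂₀, ∂₁) ∂₁, ∂₀⟩ / det g` of a metric on a plane domain
(coordinate indices `0, 1`). -/
def gaussCurvature (g : MatField 2) (x : Coord 2) : ℝ :=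
  (∑ l, g x 0 l * riemann g l 1 0 1 x) / (g x).det

/-- The Laplace-Beltrami operator `(det g)^(-1/2) ∑ᵢ ∂ᵢ ((det g)^(1/2) ∑ⱼ gⁱʲ ∂ⱼ f)`. -/
def laplacian {n : ℕ} (g : MatField n) (f : Coord n → ℝ) (x : Coord n) : ℝ :=
  (1 / Real.sqrt (g x).det) *
    ∑ i, pd i (fun y => Real.sqrt (g y).det * ∑ j, (g y)⁻¹ i j * pd j f y) x

/-- The curvature tensor vanishes on `U`. -/
def IsFlatOn {n : ℕ} (g : MatField n) (U : Set (Coord n)) : Prop :=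
  ∀ x ∈ U, ∀ l k i j, riemann g l k i j x = 0

/-- The Ricci tensor vanishes on `U`. -/
def IsRicciFlatOn {n : ℕ} (g : MatField n) (U : Set (Coord n)) : Prop :=
  ∀ x ∈ U, ∀ k j, ricci g k j x = 0

/-! ### Kähler structures -/

/-- The component `Nᵏᵢⱼ` of the Nijenhuis tensor
`N(X, Y) = [JX, JY] - J[JX, Y] - J[X, JY] - [X, Y]` of an almost complex structure; here
`J ∂ᵢ = ∑ₖ (J x k i) ∂ₖ`. -/
def nijenhuis {n : ℕ} (J : MatField n) (k i j : Fin n) (x : Coord n) : ℝ :=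
  ∑ l, (J x l i * pd l (fun y => J y k j) x - J x l j * pd l (fun y => J y k i) x
    + J x k l * (pd j (fun y => J y l i) x - pd i (fun y => J y l j) x))

/-- The component `ωᵢⱼ = g(J ∂ᵢ, ∂ⱼ)` of the fundamental form. -/
def fundForm {n : ℕ} (g J : MatField n) (i j : Fin n) (x : Coord n) : ℝ :=
  ∑ k, J x k i * g x k j

/-- `(g, J)` is a Kähler structure on `U`: `g` is a Riemannian metric, `J` is a smooth integrable
almost complex structure, `g` is `J`-Hermitian, and the fundamental form is closed. -/
structure IsKahlerOn {n : ℕ} (g J : MatField n) (U : Set (Coord n)) : Prop where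
  metric : IsMetricOn g U
  smooth : SmoothMatOn J U
  sq : ∀ x ∈ U, J x * J x = -1
  hermitian : ∀ x ∈ U, (J x).transpose * g x * J x = g x
  integrable : ∀ x ∈ U, ∀ k i j, nijenhuis J k i j x = 0
  closed : ∀ x ∈ U, ∀ i j k,
    pd i (fundForm g J j k) x + pd j (fundForm g J k i) x + pd k (fundForm g J i j) x = 0

/-! ### Foliations -/

/-- `𝓛` is the set of leaves of a smooth foliation of `M` with leaves of dimension `p` and
codimension `q`: a partition of `M` into path-connected sets such that each point of `M` lies in the
domain of a smooth chart of `M` for which the path components of the intersection of any leaf with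
the chart domain are exactly slices on which the last `q` coordinates are constant. -/
structure IsFoliationOn {n : ℕ} (p q : ℕ) (M : Set (Coord n)) (𝓛 : Set (Set (Coord n))) :
    Prop where
  sUnion_eq : ⋃₀ 𝓛 = M
  disjoint : 𝓛.PairwiseDisjoint id
  pathConnected : ∀ L ∈ 𝓛, IsPathConnected L
  exists_chart : ∀ x ∈ M, ∃ φ : OpenPartialHomeomorph (Coord n) (Coord p × Coord q),
    x ∈ φ.source ∧ φ.source ⊆ M ∧
    ContDiffOn ℝ ∞ φ φ.source ∧ ContDiffOn ℝ ∞ φ.symm φ.target ∧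
    ∀ L ∈ 𝓛, ∀ y ∈ L ∩ φ.source,
      pathComponentIn (L ∩ φ.source) y = {z | z ∈ φ.source ∧ (φ z).2 = (φ y).2}

/-- The components of the covariant derivative `∇_{∂ₐ} (∂_b f)` along a map `f` into a domain with
metric `g`. -/
def covDerivAlong {m n : ℕ} (g : MatField n) (f : Coord m → Coord n) (a b : Fin m)
    (x : Coord m) : Coord n := fun k =>
  pd a (pd b (fun y => f y k)) x
    + ∑ i, ∑ j, christoffel g k i j (f x) * pd a (fun y => f y i) x * pd b (fun y => f y j) x

/-- The `p`-dimensional leaf `L` is totally geodesic for `g`: for every smooth immersion of an open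
subset of `ℝᵖ` into `L`, the second fundamental form vanishes, that is, the vectors
`∇_{∂ₐ} (∂_b f)` are tangent to the image. -/
def IsTotallyGeodesic {n : ℕ} (p : ℕ) (g : MatField n) (L : Set (Coord n)) : Prop :=
  ∀ (V : Set (Coord p)) (f : Coord p → Coord n), IsOpen V → ContDiffOn ℝ ∞ f V →
    (∀ x ∈ V, Function.Injective (fderiv ℝ f x)) → Set.MapsTo f V L →
    ∀ x ∈ V, ∀ a b, ∃ v : Coord p, fderiv ℝ f x v = covDerivAlong g f a b x

/-- The leaf `L`, with the metric induced by `g`, is isometric to `(U, γ)`: there is a smooth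
bijection `f` of `U` onto `L` with `f^* g = γ`. As `γ` is definite, `f` is an immersion. -/
def IsIsometricLeaf {m n : ℕ} (g : MatField n) (L : Set (Coord n)) (γ : MatField m)
    (U : Set (Coord m)) : Prop :=
  ∃ f : Coord m → Coord n, ContDiffOn ℝ ∞ f U ∧ Set.BijOn f U L ∧
    ∀ x ∈ U, ∀ a b,
      ∑ i, ∑ j, g (f x) i j * pd a (fun y => f y i) x * pd b (fun y => f y j) x = γ x a b

/-! ### Killing fields -/

/-- The component `(𝓛_X g)ᵢⱼ = ∑ₖ (Xᵏ ∂ₖ gᵢⱼ + gₖⱼ ∂ᵢ Xᵏ + gᵢₖ ∂ⱼ Xᵏ)` of the Lie derivative of `g`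
along the vector field `X`. -/
def lieDerivMetric {n : ℕ} (g : MatField n) (X : Coord n → Coord n) (i j : Fin n)
    (x : Coord n) : ℝ :=
  ∑ k, (X x k * pd k (fun y => g y i j) x + g x k j * pd i (fun y => X y k) x
    + g x i k * pd j (fun y => X y k) x)

theorem pd_comp_add {n : ℕ} {X Y : Coord n → Coord n} {x : Coord n}
    (hX : ContDiffAt ℝ ∞ X x) (hY : ContDiffAt ℝ ∞ Y x) (i k : Fin n) :
    pd i (fun y => (X + Y) y k) x = pd i (fun y => X y k) x + pd i (fun y => Y y k) x := by
  have h1 : DifferentiableAt ℝ (fun y => X y k) x :=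
    differentiableAt_pi.1 (hX.differentiableAt (by simp)) k
  have h2 : DifferentiableAt ℝ (fun y => Y y k) x :=
    differentiableAt_pi.1 (hY.differentiableAt (by simp)) k
  have h := fderiv_add h1 h2
  have e : (fun y => (X + Y) y k) = (fun y => X y k) + (fun y => Y y k) := rfl
  rw [pd, e, h]
  rfl

theorem pd_comp_smul {n : ℕ} {X : Coord n → Coord n} {x : Coord n} (c : ℝ)
    (hX : ContDiffAt ℝ ∞ X x) (i k : Fin n) :
    pd i (fun y => (c • X) y k) x = c * pd i (fun y => X y k) x := by
  have h1 : DifferentiableAt ℝ (fun y => X y k) x :=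
    differentiableAt_pi.1 (hX.differentiableAt (by simp)) k
  have h := fderiv_const_smul h1 c
  have e : (fun y => (c • X) y k) = c • (fun y => X y k) := rfl
  rw [pd, e, h]
  rfl

/-- The vector space underlying the Lie algebra of Killing fields of `g` on the open set `M`:
vector fields smooth on `M` with `𝓛_X g = 0` on `M`, each represented by its extension by zero, so
that fields agreeing on `M` are identified. -/
def killingFields {n : ℕ} (g : MatField n) (M : Set (Coord n)) :
    Submodule ℝ (Coord n → Coord n) where
  carrier := {X | (∀ x ∈ M, ContDiffAt ℝ ∞ X x) ∧ (∀ x ∉ M, X x = 0) ∧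
    ∀ x ∈ M, ∀ i j, lieDerivMetric g X i j x = 0}
  zero_mem' := by
    refine ⟨fun x _ => contDiffAt_const, fun x _ => rfl, fun x _ i j => ?_⟩
    simp [lieDerivMetric, pd]
  add_mem' := by
    rintro X Y ⟨hX, hX0, hXk⟩ ⟨hY, hY0, hYk⟩
    refine ⟨fun x hx => (hX x hx).add (hY x hx), fun x hx => ?_, fun x hx i j => ?_⟩
    · simp [hX0 x hx, hY0 x hx]
    · have h : lieDerivMetric g (X + Y) i j x
          = lieDerivMetric g X i j x + lieDerivMetric g Y i j x := by
        unfold lieDerivMetric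
        rw [← Finset.sum_add_distrib]
        refine Finset.sum_congr rfl fun k _ => ?_
        rw [pd_comp_add (hX x hx) (hY x hx), pd_comp_add (hX x hx) (hY x hx)]
        simp only [Pi.add_apply]
        ring
      rw [h, hXk x hx, hYk x hx, add_zero]
  smul_mem' := by
    rintro c X ⟨hX, hX0, hXk⟩
    refine ⟨fun x hx => contDiffAt_const.smul (hX x hx), fun x hx => ?_, fun x hx i j => ?_⟩
    · simp [hX0 x hx]
    · have h : lieDerivMetric g (c • X) i j x = c * lieDerivMetric g X i j x := by
        unfold lieDerivMetric
        rw [Finset.mul_sum]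
        refine Finset.sum_congr rfl fun k _ => ?_
        rw [pd_comp_smul c (hX x hx), pd_comp_smul c (hX x hx)]
        simp only [Pi.smul_apply, smul_eq_mul]
        ring
      rw [h, hXk x hx, mul_zero]

/-! ### Leaf-like metrics -/

/-- The data `(g₀, ℓ, h)` defining a leaf-like metric on a plane domain `Ω`: a flat metric `g₀`, a
smooth positive function `ℓ` such that `ℓ g₀` has constant Gauss curvature `-2`, and a smooth
`g₀`-harmonic function `h`. -/
structure IsLeafLikeData (Ω : Set (Coord 2)) (g₀ : MatField 2) (ℓ h : Coord 2 → ℝ) : Prop where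
  isOpen : IsOpen Ω
  metric : IsMetricOn g₀ Ω
  flat : IsFlatOn g₀ Ω
  smooth_l : ContDiffOn ℝ ∞ ℓ Ω
  pos : ∀ x ∈ Ω, 0 < ℓ x
  hyperbolic : ∀ x ∈ Ω, gaussCurvature (fun y => ℓ y • g₀ y) x = -2
  smooth_h : ContDiffOn ℝ ∞ h Ω
  harmonic : ∀ x ∈ Ω, laplacian g₀ h x = 0

/-- The leaf-like metric `ℓ^(-1/2) e^(-h) g₀`. -/
def leafLikeMetric (g₀ : MatField 2) (ℓ h : Coord 2 → ℝ) : MatField 2 := fun x =>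
  (ℓ x ^ (-(1 / 2) : ℝ) * Real.exp (-h x)) • g₀ x

end LeafLike

end

/-!
A leaf-like metric is, locally, `Im T |dw|²` for a holomorphic function `T` of a complex coordinate
`w`, and `Im T |dw|²` is a totally geodesic slice of a Gibbons-Hawking metric with a two-dimensional
group of symmetries.

For the first statement, a flat metric `g₀` has flat coordinates `z = P + i Q`
(`exists_flat_coordinates`), because its connection form is closed. The formula for the curvature of
a conformal metric (`gaussCurvature_conformal`) turns the curvature condition on `ℓ g₀` into
Liouville's equation for `ψ = ℓ ^ (-1/2)`. By `exists_liouville_representation`,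
`ψ = Im τ |y|²` with `τ`, `y` holomorphic. The harmonic function `h` is the real part of a
holomorphic `F`, so the leaf-like metric is `Im τ |y|² e^{-h} |dz|² = Im τ |dw|²` for
`dw = y e^{-F/2} dz` (`IsLeafLikeData.exists_holomorphic`), and `T` is `τ` expressed in `w`.

For the second, write `T = A + i V` and `w = x₀ + i x₁`. The metric
`V (dx₀² + dx₁² + dx₃²) + V⁻¹ (dx₂ + A dx₃)²` on `D × ℝ²` is Ricci-flat, and Kähler for the complex
structure with `(1, 0)`-forms `dw`, `dx₂ + T dx₃`, whose fundamental form is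
`V dx₀ ∧ dx₁ + dx₂ ∧ dx₃`. All this follows from the Cauchy-Riemann equations for `T`. As the
components depend on `w` only, `∂₂` and `∂₃` are Killing fields, and as the metric is block diagonal,
the slices `D × {pt}` are totally geodesic (`exists_foliated_ricciFlat_kahler`).
-/

noncomputable section

namespace LeafLike

/-! ### Calculus of partial derivatives -/

section SecondDerivative

variable {E F : Type*} [NormedAddCommGroup E] [NormedSpace ℝ E] [NormedAddCommGroup F]
  [NormedSpace ℝ F] {f : E → F} {U : Set E}

theorem contDiffOn_fderiv_apply (hU : IsOpen U) (hf : ContDiffOn ℝ ∞ f U) (w : E) :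
    ContDiffOn ℝ ∞ (fun z => fderiv ℝ f z w) U :=
  (hf.fderiv_of_isOpen hU (m := ∞) (by simp)).clm_apply contDiffOn_const

theorem hasFDerivAt_fderiv_apply (hU : IsOpen U) (hf : ContDiffOn ℝ ∞ f U) {x : E} (hx : x ∈ U)
    (w : E) :
    HasFDerivAt (fun z => fderiv ℝ f z w) ((fderiv ℝ (fderiv ℝ f) x).flip w) x := by
  have hd : DifferentiableAt ℝ (fderiv ℝ f) x :=
    ((hf.contDiffAt (hU.mem_nhds hx)).fderiv_right (m := ∞) (by simp)).differentiableAt (by simp)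
  refine (hd.hasFDerivAt.clm_apply (hasFDerivAt_const w x)).congr_fderiv ?_
  ext
  simp

theorem isSymmSndFDerivAt_of_contDiffOn (hU : IsOpen U) (hf : ContDiffOn ℝ ∞ f U) {x : E}
    (hx : x ∈ U) : IsSymmSndFDerivAt ℝ f x :=
  (hf.contDiffAt (hU.mem_nhds hx)).isSymmSndFDerivAt
    (by simpa using WithTop.coe_le_coe.2 (le_top : (2 : ℕ∞) ≤ ⊤))

end SecondDerivative

/-- `f` is differentiable at `x` and its `i`-th partial derivative there is `d`. -/
def HasPd {m : ℕ} (i : Fin m) (f : Coord m → ℝ) (d : ℝ) (x : Coord m) : Prop :=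
  DifferentiableAt ℝ f x ∧ pd i f x = d

section HasPd

variable {m : ℕ} {i : Fin m} {f g : Coord m → ℝ} {a b : ℝ} {x : Coord m}

theorem _root_.HasFDerivAt.hasPd {L : Coord m →L[ℝ] ℝ} (h : HasFDerivAt f L x) :
    HasPd i f (L (Pi.single i 1)) x :=
  ⟨h.differentiableAt, by rw [pd, h.fderiv]⟩

theorem _root_.DifferentiableAt.hasPd (h : DifferentiableAt ℝ f x) : HasPd i f (pd i f x) x :=
  ⟨h, rfl⟩

theorem hasPd_const (c : ℝ) : HasPd i (fun _ => c) 0 x :=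
  ⟨differentiableAt_const c, by simp [pd]⟩

theorem HasPd.congr_val (hf : HasPd i f a x) (h : a = b) : HasPd i f b x := h ▸ hf

theorem HasPd.add (hf : HasPd i f a x) (hg : HasPd i g b x) :
    HasPd i (fun y => f y + g y) (a + b) x := by
  refine ⟨hf.1.add hg.1, ?_⟩
  rw [← hf.2, ← hg.2, pd, fderiv_fun_add hf.1 hg.1]
  rfl

theorem HasPd.neg (hf : HasPd i f a x) : HasPd i (fun y => -f y) (-a) x := by
  refine ⟨hf.1.neg, ?_⟩
  rw [← hf.2, pd, fderiv_fun_neg]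
  rfl

theorem HasPd.sub (hf : HasPd i f a x) (hg : HasPd i g b x) :
    HasPd i (fun y => f y - g y) (a - b) x := by
  simpa only [sub_eq_add_neg] using hf.add hg.neg

theorem HasPd.mul (hf : HasPd i f a x) (hg : HasPd i g b x) :
    HasPd i (fun y => f y * g y) (f x * b + g x * a) x := by
  refine ⟨hf.1.mul hg.1, ?_⟩
  rw [← hf.2, ← hg.2, pd, fderiv_fun_mul hf.1 hg.1]
  rfl

theorem HasPd.const_mul (c : ℝ) (hf : HasPd i f a x) :
    HasPd i (fun y => c * f y) (c * a) x := by
  simpa using (hasPd_const c).mul hf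

theorem HasPd.inv (hf : HasPd i f a x) (h0 : f x ≠ 0) :
    HasPd i (fun y => (f y)⁻¹) (-(f x)⁻¹ ^ 2 * a) x := by
  have h := (hasDerivAt_inv h0).comp_hasFDerivAt x hf.1.hasFDerivAt
  refine (h.hasPd (i := i)).congr_val ?_
  rw [← hf.2]
  simp [pd]

theorem HasPd.div (hf : HasPd i f a x) (hg : HasPd i g b x) (h0 : g x ≠ 0) :
    HasPd i (fun y => f y / g y) ((a * g x - f x * b) / g x ^ 2) x := by
  have h : HasPd i (fun y => f y * (g y)⁻¹) _ x := hf.mul (hg.inv h0)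
  have e : (fun y => f y / g y) = fun y => f y * (g y)⁻¹ := funext fun y => div_eq_mul_inv _ _
  rw [e]
  refine h.congr_val ?_
  field_simp
  ring

end HasPd

theorem pd_congr {m : ℕ} {i : Fin m} {f g : Coord m → ℝ} {U : Set (Coord m)} (hU : IsOpen U)
    (h : ∀ y ∈ U, f y = g y) {x : Coord m} (hx : x ∈ U) : pd i f x = pd i g x := by
  have : f =ᶠ[nhds x] g := Filter.eventually_of_mem (hU.mem_nhds hx) h
  rw [pd, pd, this.fderiv_eq]

/-! ### The Gibbons-Hawking metric of a holomorphic function -/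

/-- The complex coordinate `x₀ + i x₁` on `ℝ⁴`. -/
def plane : Coord 4 →L[ℝ] ℂ :=
  (ContinuousLinearMap.proj 0).smulRight (1 : ℂ) + (ContinuousLinearMap.proj 1).smulRight Complex.I

theorem plane_apply (x : Coord 4) : plane x = x 0 + x 1 * Complex.I := by
  simp [plane]

/-- The derivative `∂ᵢ (x₀ + i x₁)`. -/
def planeVec : Fin 4 → ℂ := ![1, Complex.I, 0, 0]

theorem plane_single (i : Fin 4) : plane (Pi.single i 1) = planeVec i := by
  rw [plane_apply]
  fin_cases i <;> simp [planeVec]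

/-- The metric `V (dx₀² + dx₁² + dx₃²) + V⁻¹ (dx₂ + A dx₃)²` on `ℝ⁴`, where `V` and `A` are the
imaginary and the real part of `T (x₀ + i x₁)`. -/
def ghMetric (T : ℂ → ℂ) : MatField 4 := fun x =>
  let V := (T (plane x)).im
  let A := (T (plane x)).re
  !![V, 0, 0, 0; 0, V, 0, 0; 0, 0, V⁻¹, A * V⁻¹; 0, 0, A * V⁻¹, A ^ 2 * V⁻¹ + V]

/-- The complex structure for which `d(x₀ + i x₁)` and `dx₂ + T dx₃` have type `(1, 0)`. -/
def ghComplexStructure (T : ℂ → ℂ) : MatField 4 := fun x =>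
  let V := (T (plane x)).im
  let A := (T (plane x)).re
  !![0, -1, 0, 0; 1, 0, 0, 0; 0, 0, -(A * V⁻¹), -(V + A ^ 2 * V⁻¹); 0, 0, V⁻¹, A * V⁻¹]

/-- The inverse of `ghMetric`. -/
def ghInverse (T : ℂ → ℂ) : MatField 4 := fun x =>
  let V := (T (plane x)).im
  let A := (T (plane x)).re
  !![V⁻¹, 0, 0, 0; 0, V⁻¹, 0, 0; 0, 0, V + A ^ 2 * V⁻¹, -(A * V⁻¹); 0, 0, -(A * V⁻¹), V⁻¹]

/-- The domain of `ℝ⁴` lying over a plane domain. -/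
def cylinder (D : Set ℂ) : Set (Coord 4) := plane ⁻¹' D

section GH

variable {T : ℂ → ℂ} {D : Set ℂ}

theorem isOpen_cylinder (hD : IsOpen D) : IsOpen (cylinder D) := hD.preimage plane.continuous

theorem ghMetric_inv {x : Coord 4} (hV : (T (plane x)).im ≠ 0) :
    (ghMetric T x)⁻¹ = ghInverse T x := by
  apply Matrix.inv_eq_right_inv
  ext i j
  fin_cases i <;> fin_cases j <;>
    simp [ghMetric, ghInverse, Matrix.mul_apply, Fin.sum_univ_four] <;> field_simp <;> ring

theorem hasPd_re {z' : ℂ} {x : Coord 4} (h : HasDerivAt T z' (plane x)) (i : Fin 4) :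
    HasPd i (fun y => (T (plane y)).re) (z' * planeVec i).re x := by
  have h1 := (h.hasFDerivAt.restrictScalars ℝ).comp x plane.hasFDerivAt
  have h2 := (Complex.reCLM.hasFDerivAt.comp x h1).hasPd (i := i)
  refine h2.congr_val ?_
  simp [plane_single, mul_comm]

theorem hasPd_im {z' : ℂ} {x : Coord 4} (h : HasDerivAt T z' (plane x)) (i : Fin 4) :
    HasPd i (fun y => (T (plane y)).im) (z' * planeVec i).im x := by
  have h1 := (h.hasFDerivAt.restrictScalars ℝ).comp x plane.hasFDerivAt
  have h2 := (Complex.imCLM.hasFDerivAt.comp x h1).hasPd (i := i)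
  refine h2.congr_val ?_
  simp [plane_single, mul_comm]

theorem hasPd_im_inv {z' : ℂ} {x : Coord 4} (h : HasDerivAt T z' (plane x))
    (hV : (T (plane x)).im ≠ 0) (i : Fin 4) :
    HasPd i (fun y => ((T (plane y)).im)⁻¹) (-((T (plane x)).im)⁻¹ ^ 2 * (z' * planeVec i).im) x :=
  (hasPd_im h i).inv hV

/-- The derivative of `ghMetric` in a direction in which `V`, `A` have derivatives `v`, `a`. -/
def ghMetricDeriv (V A v a : ℝ) : Matrix (Fin 4) (Fin 4) ℝ :=
  let W := V⁻¹
  !![v, 0, 0, 0; 0, v, 0, 0; 0, 0, -W ^ 2 * v, a * W - A * W ^ 2 * v;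
    0, 0, a * W - A * W ^ 2 * v, 2 * A * a * W - A ^ 2 * W ^ 2 * v + v]

theorem hasPd_ghMetric {z' : ℂ} {x : Coord 4} (h : HasDerivAt T z' (plane x))
    (hV : (T (plane x)).im ≠ 0) (l i j : Fin 4) :
    HasPd l (fun y => ghMetric T y i j)
      (ghMetricDeriv (T (plane x)).im (T (plane x)).re (z' * planeVec l).im (z' * planeVec l).re i j)
      x := by
  have hW := hasPd_im_inv h hV l
  have hA := hasPd_re h l
  have hv := hasPd_im h l
  have h23 := (hA.mul hW).congr_val (b := (z' * planeVec l).re * ((T (plane x)).im)⁻¹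
    - (T (plane x)).re * ((T (plane x)).im)⁻¹ ^ 2 * (z' * planeVec l).im) (by ring)
  have h33 := (((hA.mul hA).mul hW).add hv).congr_val
    (b := 2 * (T (plane x)).re * (z' * planeVec l).re * ((T (plane x)).im)⁻¹
    - (T (plane x)).re ^ 2 * ((T (plane x)).im)⁻¹ ^ 2 * (z' * planeVec l).im
    + (z' * planeVec l).im) (by ring)
  simp only [← pow_two] at h33
  have h0 : HasPd l (fun _ => (0 : ℝ)) 0 x := hasPd_const 0
  fin_cases i <;> fin_cases j <;>
    simp only [ghMetric, ghMetricDeriv, Matrix.of_apply, Matrix.cons_val', Matrix.cons_val_zero,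
      Matrix.cons_val_one, Matrix.cons_val, Matrix.cons_val_fin_one, Fin.zero_eta, Fin.mk_one,
      Fin.reduceFinMk] <;> assumption

/-- The Christoffel symbols of `ghMetric`, as functions of `W = V⁻¹`, `A` and the partial
derivatives `v`, `a` of `V` and `A`. -/
def ghGamma (W A : ℝ) (v a : Fin 4 → ℝ) (k : Fin 4) : Matrix (Fin 4) (Fin 4) ℝ :=
  let B := fun c => 1 / 2 * (W * v c)
  let E22 := fun c => 1 / 2 * (W ^ 3 * v c)
  let E23 := fun c => 1 / 2 * (A * W ^ 3 * v c - W ^ 2 * a c)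
  let E33 := fun c => 1 / 2 * (A ^ 2 * W ^ 3 * v c - 2 * A * W ^ 2 * a c - W * v c)
  let H22 := fun c => -(1 / 2) * (W * v c + A * W ^ 2 * a c)
  let H23 := fun c => 1 / 2 * (a c - 2 * A * W * v c - A ^ 2 * W ^ 2 * a c)
  let H32 := fun c => 1 / 2 * (W ^ 2 * a c)
  let H33 := fun c => 1 / 2 * (W * v c + A * W ^ 2 * a c)
  match k with
  | 0 => !![B 0, B 1, 0, 0; B 1, -B 0, 0, 0; 0, 0, E22 0, E23 0; 0, 0, E23 0, E33 0]
  | 1 => !![-B 1, B 0, 0, 0; B 0, B 1, 0, 0; 0, 0, E22 1, E23 1; 0, 0, E23 1, E33 1]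
  | 2 => !![0, 0, H22 0, H23 0; 0, 0, H22 1, H23 1; H22 0, H22 1, 0, 0; H23 0, H23 1, 0, 0]
  | 3 => !![0, 0, H32 0, H33 0; 0, 0, H32 1, H33 1; H32 0, H32 1, 0, 0; H33 0, H33 1, 0, 0]

/-- The derivative of `ghGamma` in a direction in which its arguments have derivatives
`W'`, `A'`, `v'`, `a'`. -/
def ghGammaDeriv (W A : ℝ) (v a : Fin 4 → ℝ) (W' A' : ℝ) (v' a' : Fin 4 → ℝ) (k : Fin 4) :
    Matrix (Fin 4) (Fin 4) ℝ :=
  let B := fun c => 1 / 2 * (W' * v c + W * v' c)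
  let E22 := fun c => 1 / 2 * (3 * W ^ 2 * W' * v c + W ^ 3 * v' c)
  let E23 := fun c => 1 / 2 * (A' * W ^ 3 * v c + 3 * A * W ^ 2 * W' * v c + A * W ^ 3 * v' c
    - 2 * W * W' * a c - W ^ 2 * a' c)
  let E33 := fun c => 1 / 2 * (2 * A * A' * W ^ 3 * v c + 3 * A ^ 2 * W ^ 2 * W' * v c
    + A ^ 2 * W ^ 3 * v' c - 2 * A' * W ^ 2 * a c - 4 * A * W * W' * a c - 2 * A * W ^ 2 * a' c
    - W' * v c - W * v' c)
  let H33 := fun c => 1 / 2 * (W' * v c + W * v' c + A' * W ^ 2 * a c + 2 * A * W * W' * a c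
    + A * W ^ 2 * a' c)
  let H22 := fun c => -H33 c
  let H23 := fun c => 1 / 2 * (a' c - 2 * A' * W * v c - 2 * A * W' * v c - 2 * A * W * v' c
    - 2 * A * A' * W ^ 2 * a c - 2 * A ^ 2 * W * W' * a c - A ^ 2 * W ^ 2 * a' c)
  let H32 := fun c => 1 / 2 * (2 * W * W' * a c + W ^ 2 * a' c)
  match k with
  | 0 => !![B 0, B 1, 0, 0; B 1, -B 0, 0, 0; 0, 0, E22 0, E23 0; 0, 0, E23 0, E33 0]
  | 1 => !![-B 1, B 0, 0, 0; B 0, B 1, 0, 0; 0, 0, E22 1, E23 1; 0, 0, E23 1, E33 1]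
  | 2 => !![0, 0, H22 0, H23 0; 0, 0, H22 1, H23 1; H22 0, H22 1, 0, 0; H23 0, H23 1, 0, 0]
  | 3 => !![0, 0, H32 0, H33 0; 0, 0, H32 1, H33 1; H32 0, H32 1, 0, 0; H33 0, H33 1, 0, 0]

set_option maxHeartbeats 1000000 in
theorem hasPd_ghGamma {W A : Coord 4 → ℝ} {v a : Fin 4 → Coord 4 → ℝ} {W' A' : ℝ}
    {v' a' : Fin 4 → ℝ} {l : Fin 4} {x : Coord 4} (hW : HasPd l W W' x) (hA : HasPd l A A' x)
    (hv : ∀ c, HasPd l (v c) (v' c) x) (ha : ∀ c, HasPd l (a c) (a' c) x) (k i j : Fin 4) :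
    HasPd l (fun y => ghGamma (W y) (A y) (v · y) (a · y) k i j)
      (ghGammaDeriv (W x) (A x) (v · x) (a · x) W' A' v' a' k i j) x := by
  have h0 : HasPd l (fun _ => (0 : ℝ)) 0 x := hasPd_const 0
  have hW2 : HasPd l (fun y => W y ^ 2) (2 * W x * W') x := by
    simpa only [pow_two] using (hW.mul hW).congr_val (b := 2 * W x * W') (by ring)
  have hW3 : HasPd l (fun y => W y ^ 3) (3 * W x ^ 2 * W') x := by
    simpa only [pow_succ, pow_zero, one_mul] using
      ((hW.mul hW).mul hW).congr_val (b := 3 * (W x * W x) * W') (by ring)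
  have hA2 : HasPd l (fun y => A y ^ 2) (2 * A x * A') x := by
    simpa only [pow_two] using (hA.mul hA).congr_val (b := 2 * A x * A') (by ring)
  have hB := fun c => (hW.mul (hv c)).const_mul (1 / 2)
  have hB' := fun c => ((hW.mul (hv c)).const_mul (1 / 2)).neg
  have hE22 := fun c => (hW3.mul (hv c)).const_mul (1 / 2)
  have hE23 := fun c => (((hA.mul hW3).mul (hv c)).sub (hW2.mul (ha c))).const_mul (1 / 2)
  have hE33 := fun c => ((((hA2.mul hW3).mul (hv c)).sub
    (((hA.const_mul 2).mul hW2).mul (ha c))).sub (hW.mul (hv c))).const_mul (1 / 2)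
  have hH33 := fun c => ((hW.mul (hv c)).add ((hA.mul hW2).mul (ha c))).const_mul (1 / 2)
  have hH22 := fun c => ((hW.mul (hv c)).add ((hA.mul hW2).mul (ha c))).const_mul (-(1 / 2))
  have hH23 := fun c => (((ha c).sub (((hA.const_mul 2).mul hW).mul (hv c))).sub
    ((hA2.mul hW2).mul (ha c))).const_mul (1 / 2)
  have hH32 := fun c => (hW2.mul (ha c)).const_mul (1 / 2)
  fin_cases k <;> fin_cases i <;> fin_cases j <;>
    simp only [ghGamma, ghGammaDeriv, Matrix.of_apply, Matrix.cons_val', Matrix.cons_val_zero,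
      Matrix.cons_val_one, Matrix.cons_val, Matrix.cons_val_fin_one, Fin.zero_eta, Fin.mk_one,
      Fin.reduceFinMk] <;>
    first
    | exact h0
    | exact (hB _).congr_val (by ring)
    | exact (hB' _).congr_val (by ring)
    | exact (hE22 _).congr_val (by ring)
    | exact (hE23 _).congr_val (by ring)
    | exact (hE33 _).congr_val (by ring)
    | exact (hH33 _).congr_val (by ring)
    | exact (hH22 _).congr_val (by ring)
    | exact (hH23 _).congr_val (by ring)
    | exact (hH32 _).congr_val (by ring)

set_option maxHeartbeats 1000000 in
theorem christoffel_ghMetric {z' : ℂ} {x : Coord 4} (h : HasDerivAt T z' (plane x))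
    (hV : (T (plane x)).im ≠ 0) (k i j : Fin 4) :
    christoffel (ghMetric T) k i j x =
      ghGamma ((T (plane x)).im)⁻¹ (T (plane x)).re (fun c => (z' * planeVec c).im)
        (fun c => (z' * planeVec c).re) k i j := by
  rw [christoffel, ghMetric_inv hV]
  simp only [(hasPd_ghMetric h hV _ _ _).2]
  fin_cases k <;> fin_cases i <;> fin_cases j <;>
    simp [Fin.sum_univ_four, ghGamma, ghMetricDeriv, ghInverse, planeVec] <;> field_simp <;> ring

set_option maxHeartbeats 1000000 in
/-- The metric `ghMetric T` is Ricci-flat for every holomorphic `T`. -/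
theorem isRicciFlatOn_ghMetric (hD : IsOpen D) (hT : DifferentiableOn ℂ T D)
    (hpos : ∀ z ∈ D, 0 < (T z).im) : IsRicciFlatOn (ghMetric T) (cylinder D) := by
  intro x hx k j
  have hT1 : ∀ z ∈ D, HasDerivAt T (deriv T z) z := fun z hz =>
    (hT.differentiableAt (hD.mem_nhds hz)).hasDerivAt
  have hT2 : HasDerivAt (deriv T) (deriv (deriv T) (plane x)) (plane x) :=
    ((hT.deriv hD).differentiableAt (hD.mem_nhds hx)).hasDerivAt
  have hpd : ∀ l k i j, pd l (christoffel (ghMetric T) k i j) x = _ := fun l k i j =>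
    (pd_congr (isOpen_cylinder hD) (fun y hy => christoffel_ghMetric (hT1 _ hy)
      (hpos _ hy).ne' k i j) hx).trans
    (hasPd_ghGamma (hasPd_im_inv (hT1 _ hx) (hpos _ hx).ne' l) (hasPd_re (hT1 _ hx) l)
      (v := fun c y => (deriv T (plane y) * planeVec c).im)
      (a := fun c y => (deriv T (plane y) * planeVec c).re)
      (fun c => hasPd_im (T := fun z => deriv T z * planeVec c) (hT2.mul_const (planeVec c)) l)
      (fun c => hasPd_re (T := fun z => deriv T z * planeVec c) (hT2.mul_const (planeVec c)) l)
      k i j).2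
  simp only [ricci, riemann, hpd, christoffel_ghMetric (hT1 _ hx) (hpos _ hx).ne']
  generalize deriv (deriv T) (plane x) = t2
  generalize deriv T (plane x) = t1
  generalize ((T (plane x)).im)⁻¹ = W
  generalize (T (plane x)).re = A
  fin_cases k <;> fin_cases j <;>
    simp [Fin.sum_univ_four, ghGamma, ghGammaDeriv, planeVec] <;> ring

end GH

/-! ### The Kähler structure -/

section GH

variable {T : ℂ → ℂ} {D : Set ℂ}

theorem contDiffOn_comp_plane (hD : IsOpen D) (hT : DifferentiableOn ℂ T D) :
    ContDiffOn ℝ ∞ (fun x => T (plane x)) (cylinder D) := by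
  have h : ContDiffOn ℝ ∞ T D := (hT.contDiffOn hD).restrict_scalars ℝ
  exact h.comp plane.contDiff.contDiffOn fun x hx => hx

theorem contDiffOn_re_comp_plane (hD : IsOpen D) (hT : DifferentiableOn ℂ T D) :
    ContDiffOn ℝ ∞ (fun x => (T (plane x)).re) (cylinder D) :=
  Complex.reCLM.contDiff.comp_contDiffOn (contDiffOn_comp_plane hD hT)

theorem contDiffOn_im_comp_plane (hD : IsOpen D) (hT : DifferentiableOn ℂ T D) :
    ContDiffOn ℝ ∞ (fun x => (T (plane x)).im) (cylinder D) :=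
  Complex.imCLM.contDiff.comp_contDiffOn (contDiffOn_comp_plane hD hT)

theorem isMetricOn_ghMetric (hD : IsOpen D) (hT : DifferentiableOn ℂ T D)
    (hpos : ∀ z ∈ D, 0 < (T z).im) : IsMetricOn (ghMetric T) (cylinder D) := by
  refine ⟨fun i j => ?_, fun x hx => ?_⟩
  · have hA := contDiffOn_re_comp_plane hD hT
    have hV := contDiffOn_im_comp_plane hD hT
    have hW := hV.inv fun x hx => (hpos _ hx).ne'
    fin_cases i <;> fin_cases j <;> simp [ghMetric] <;>
      first
      | exact contDiffOn_const
      | exact hV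
      | exact hW
      | exact hA.mul hW
      | exact ((hA.pow 2).mul hW).add hV
  · have hV : 0 < (T (plane x)).im := hpos _ hx
    refine Matrix.PosDef.of_dotProduct_mulVec_pos ?_ fun y hy => ?_
    · ext i j
      fin_cases i <;> fin_cases j <;> simp [ghMetric]
    · have key : star y ⬝ᵥ (ghMetric T x).mulVec y = (T (plane x)).im * (y 0 ^ 2 + y 1 ^ 2 + y 3 ^ 2)
          + (T (plane x)).im⁻¹ * (y 2 + (T (plane x)).re * y 3) ^ 2 := by
        simp [ghMetric, dotProduct, Matrix.mulVec, Fin.sum_univ_four]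
        ring
      rw [key]
      have h1 : 0 ≤ (T (plane x)).im * (y 0 ^ 2 + y 1 ^ 2 + y 3 ^ 2) := by positivity
      have h2 : 0 ≤ (T (plane x)).im⁻¹ * (y 2 + (T (plane x)).re * y 3) ^ 2 := by positivity
      refine lt_of_le_of_ne (add_nonneg h1 h2) fun h0 => hy ?_
      have e1 : y 0 ^ 2 + y 1 ^ 2 + y 3 ^ 2 = 0 := by
        have : (T (plane x)).im * (y 0 ^ 2 + y 1 ^ 2 + y 3 ^ 2) = 0 := by linarith
        exact (mul_eq_zero.1 this).resolve_left hV.ne'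
      have e2 : (y 2 + (T (plane x)).re * y 3) ^ 2 = 0 := by
        have : (T (plane x)).im⁻¹ * (y 2 + (T (plane x)).re * y 3) ^ 2 = 0 := by linarith
        exact (mul_eq_zero.1 this).resolve_left (inv_pos.2 hV).ne'
      have y0 : y 0 = 0 := by nlinarith [sq_nonneg (y 0), sq_nonneg (y 1), sq_nonneg (y 3)]
      have y1 : y 1 = 0 := by nlinarith [sq_nonneg (y 0), sq_nonneg (y 1), sq_nonneg (y 3)]
      have y3 : y 3 = 0 := by nlinarith [sq_nonneg (y 0), sq_nonneg (y 1), sq_nonneg (y 3)]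
      have y2 : y 2 = 0 := by simpa [y3] using e2
      ext i
      fin_cases i <;> assumption

/-- The derivative of `ghComplexStructure` in a direction in which `V`, `A` have derivatives
`v`, `a`. -/
def ghComplexStructureDeriv (V A v a : ℝ) : Matrix (Fin 4) (Fin 4) ℝ :=
  let W := V⁻¹
  !![0, 0, 0, 0; 0, 0, 0, 0; 0, 0, -(a * W - A * W ^ 2 * v),
    -(2 * A * a * W - A ^ 2 * W ^ 2 * v + v); 0, 0, -W ^ 2 * v, a * W - A * W ^ 2 * v]

theorem hasPd_ghComplexStructure {z' : ℂ} {x : Coord 4} (h : HasDerivAt T z' (plane x))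
    (hV : (T (plane x)).im ≠ 0) (l i j : Fin 4) :
    HasPd l (fun y => ghComplexStructure T y i j)
      (ghComplexStructureDeriv (T (plane x)).im (T (plane x)).re (z' * planeVec l).im
        (z' * planeVec l).re i j) x := by
  have hW := hasPd_im_inv h hV l
  have hA := hasPd_re h l
  have hv := hasPd_im h l
  have h23 := (hA.mul hW).congr_val (b := (z' * planeVec l).re * ((T (plane x)).im)⁻¹
    - (T (plane x)).re * ((T (plane x)).im)⁻¹ ^ 2 * (z' * planeVec l).im) (by ring)
  have h33 := (hv.add ((hA.mul hA).mul hW)).neg.congr_val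
    (b := -(2 * (T (plane x)).re * (z' * planeVec l).re * ((T (plane x)).im)⁻¹
    - (T (plane x)).re ^ 2 * ((T (plane x)).im)⁻¹ ^ 2 * (z' * planeVec l).im
    + (z' * planeVec l).im)) (by ring)
  simp only [← pow_two] at h33
  have h22 := h23.neg
  have h0 : HasPd l (fun _ => (0 : ℝ)) 0 x := hasPd_const 0
  have h1 : HasPd l (fun _ => (1 : ℝ)) 0 x := hasPd_const 1
  have h1' : HasPd l (fun _ => (-1 : ℝ)) 0 x := hasPd_const (-1)
  fin_cases i <;> fin_cases j <;>
    simp only [ghComplexStructure, ghComplexStructureDeriv, Matrix.of_apply, Matrix.cons_val',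
      Matrix.cons_val_zero, Matrix.cons_val_one, Matrix.cons_val, Matrix.cons_val_fin_one,
      Fin.zero_eta, Fin.mk_one, Fin.reduceFinMk] <;> assumption

theorem fundForm_gh {x : Coord 4} (hV : (T (plane x)).im ≠ 0) (i j : Fin 4) :
    fundForm (ghMetric T) (ghComplexStructure T) i j x =
      !![0, (T (plane x)).im, 0, 0; -(T (plane x)).im, 0, 0, 0; 0, 0, 0, 1; 0, 0, -1, 0] i j := by
  fin_cases i <;> fin_cases j <;>
    simp [fundForm, ghMetric, ghComplexStructure, Fin.sum_univ_four] <;> field_simp <;> ring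

/-- The fundamental form of the Gibbons-Hawking structure is `V dx₀ ∧ dx₁ + dx₂ ∧ dx₃`, which is
closed because `V` depends on `x₀`, `x₁` only. -/
theorem pd_fundForm_gh (hD : IsOpen D) (hT : DifferentiableOn ℂ T D)
    (hpos : ∀ z ∈ D, 0 < (T z).im) {x : Coord 4} (hx : x ∈ cylinder D) (l i j : Fin 4) :
    pd l (fundForm (ghMetric T) (ghComplexStructure T) i j) x =
      !![0, (deriv T (plane x) * planeVec l).im, 0, 0; -(deriv T (plane x) * planeVec l).im, 0, 0, 0;
        0, 0, 0, 0; 0, 0, 0, 0] i j := by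
  rw [pd_congr (isOpen_cylinder hD) (fun y hy => fundForm_gh (hpos _ hy).ne' i j) hx]
  have hv := hasPd_im ((hT.differentiableAt (hD.mem_nhds hx)).hasDerivAt) l
  have hv' := hv.neg
  have h0 : HasPd l (fun _ => (0 : ℝ)) 0 x := hasPd_const 0
  have h1 : HasPd l (fun _ => (1 : ℝ)) 0 x := hasPd_const 1
  have h1' : HasPd l (fun _ => (-1 : ℝ)) 0 x := hasPd_const (-1)
  fin_cases i <;> fin_cases j <;>
    simp only [Matrix.of_apply, Matrix.cons_val',
      Matrix.cons_val_zero, Matrix.cons_val_one, Matrix.cons_val, Matrix.cons_val_fin_one,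
      Fin.zero_eta, Fin.mk_one, Fin.reduceFinMk] <;>
    first
    | exact h0.2
    | exact h1.2
    | exact h1'.2
    | exact hv.2
    | exact hv'.2

set_option maxHeartbeats 1000000 in
/-- The Nijenhuis tensor vanishes by the Cauchy-Riemann equations for `T`. -/
theorem nijenhuis_gh {z' : ℂ} {x : Coord 4} (h : HasDerivAt T z' (plane x))
    (hV : (T (plane x)).im ≠ 0) (k i j : Fin 4) :
    nijenhuis (ghComplexStructure T) k i j x = 0 := by
  simp only [nijenhuis, (hasPd_ghComplexStructure h hV _ _ _).2]
  fin_cases k <;> fin_cases i <;> fin_cases j <;>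
    simp [Fin.sum_univ_four, ghComplexStructure, ghComplexStructureDeriv, planeVec] <;>
    field_simp <;> ring

theorem isKahlerOn_gh (hD : IsOpen D) (hT : DifferentiableOn ℂ T D)
    (hpos : ∀ z ∈ D, 0 < (T z).im) :
    IsKahlerOn (ghMetric T) (ghComplexStructure T) (cylinder D) := by
  refine ⟨isMetricOn_ghMetric hD hT hpos, fun i j => ?_, fun x hx => ?_, fun x hx => ?_,
    fun x hx k i j => ?_, fun x hx i j k => ?_⟩
  · have hA := contDiffOn_re_comp_plane hD hT
    have hV := contDiffOn_im_comp_plane hD hT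
    have hW := hV.inv fun x hx => (hpos _ hx).ne'
    fin_cases i <;> fin_cases j <;> simp [ghComplexStructure] <;>
      first
      | exact contDiffOn_const
      | exact hW
      | exact hA.mul hW
      | exact (hA.mul hW).neg
      | exact (((hA.pow 2).mul hW).neg).add hV.neg
  · have hV : (T (plane x)).im ≠ 0 := (hpos _ hx).ne'
    ext i j
    fin_cases i <;> fin_cases j <;>
      simp [ghComplexStructure, Matrix.mul_apply, Fin.sum_univ_four] <;> field_simp <;> ring
  · have hV : (T (plane x)).im ≠ 0 := (hpos _ hx).ne'
    ext i j
    fin_cases i <;> fin_cases j <;>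
      simp [ghComplexStructure, ghMetric, Matrix.mul_apply, Fin.sum_univ_four] <;>
      field_simp <;> ring
  · exact nijenhuis_gh ((hT.differentiableAt (hD.mem_nhds hx)).hasDerivAt) (hpos _ hx).ne' k i j
  · simp only [pd_fundForm_gh hD hT hpos hx]
    fin_cases i <;> fin_cases j <;> fin_cases k <;> simp [planeVec]

end GH

/-! ### Leaves and Killing fields -/

section Leaves

variable {T : ℂ → ℂ} {D : Set ℂ}

/-- The point of `ℝ⁴` with complex coordinate `z` and fibre coordinates `w`. -/
def embed (w : ℝ × ℝ) (z : ℂ) : Coord 4 := ![z.re, z.im, w.1, w.2]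

theorem plane_embed (w : ℝ × ℝ) (z : ℂ) : plane (embed w z) = z := by
  simp [plane_apply, embed]

theorem contDiff_embed (w : ℝ × ℝ) : ContDiff ℝ ∞ (embed w) := by
  refine contDiff_pi.2 fun i => ?_
  fin_cases i
  · exact Complex.reCLM.contDiff
  · exact Complex.imCLM.contDiff
  · exact contDiff_const
  · exact contDiff_const

/-- The slice of the cylinder over `D` on which the fibre coordinates are `w`. -/
def slice (D : Set ℂ) (w : ℝ × ℝ) : Set (Coord 4) := {x | plane x ∈ D ∧ x 2 = w.1 ∧ x 3 = w.2}

theorem image_embed (w : ℝ × ℝ) : embed w '' D = slice D w := by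
  ext x
  constructor
  · rintro ⟨z, hz, rfl⟩
    exact ⟨by rwa [plane_embed], rfl, rfl⟩
  · rintro ⟨hx, h2, h3⟩
    refine ⟨plane x, hx, ?_⟩
    ext i
    fin_cases i <;> simp [embed, plane_apply, h2, h3]

theorem isPathConnected_slice (hc : Convex ℝ D) (hne : D.Nonempty) (w : ℝ × ℝ) :
    IsPathConnected (slice D w) := by
  rw [← image_embed]
  exact (hc.isPathConnected hne).image (contDiff_embed w).continuous

/-- The splitting of `ℝ⁴` into base and fibre coordinates. -/
def splitHomeomorph : Coord 4 ≃ₜ Coord 2 × Coord 2 where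
  toFun x := (![x 0, x 1], ![x 2, x 3])
  invFun p := ![p.1 0, p.1 1, p.2 0, p.2 1]
  left_inv x := by ext i; fin_cases i <;> rfl
  right_inv p := by ext i <;> fin_cases i <;> rfl
  continuous_toFun := by
    refine Continuous.prodMk (continuous_pi fun i => ?_) (continuous_pi fun i => ?_) <;>
      fin_cases i <;> exact continuous_apply _
  continuous_invFun := by
    refine continuous_pi fun i => ?_
    fin_cases i
    · exact (continuous_apply (0 : Fin 2)).comp continuous_fst
    · exact (continuous_apply (1 : Fin 2)).comp continuous_fst
    · exact (continuous_apply (0 : Fin 2)).comp continuous_snd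
    · exact (continuous_apply (1 : Fin 2)).comp continuous_snd

theorem contDiff_splitHomeomorph : ContDiff ℝ ∞ splitHomeomorph := by
  refine ContDiff.prodMk (contDiff_pi.2 fun i => ?_) (contDiff_pi.2 fun i => ?_) <;>
    fin_cases i <;> exact contDiff_apply ℝ ℝ _

theorem contDiff_splitHomeomorph_symm : ContDiff ℝ ∞ splitHomeomorph.symm := by
  refine contDiff_pi.2 fun i => ?_
  fin_cases i
  · exact (contDiff_apply ℝ ℝ (0 : Fin 2)).comp contDiff_fst
  · exact (contDiff_apply ℝ ℝ (1 : Fin 2)).comp contDiff_fst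
  · exact (contDiff_apply ℝ ℝ (0 : Fin 2)).comp contDiff_snd
  · exact (contDiff_apply ℝ ℝ (1 : Fin 2)).comp contDiff_snd

theorem isFoliationOn_slice (hD : IsOpen D) (hc : Convex ℝ D) (hne : D.Nonempty) :
    IsFoliationOn 2 2 (cylinder D) (Set.range (slice D)) := by
  refine ⟨?_, ?_, ?_, fun x hx => ?_⟩
  · ext x
    simp only [Set.sUnion_range, Set.mem_iUnion]
    exact ⟨fun ⟨w, hw⟩ => hw.1, fun hx => ⟨(x 2, x 3), hx, rfl, rfl⟩⟩
  · rintro _ ⟨w, rfl⟩ _ ⟨w', rfl⟩ hww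
    refine Set.disjoint_left.2 fun x hx hx' => hww ?_
    have : w = w' := Prod.ext (hx.2.1.symm.trans hx'.2.1) (hx.2.2.symm.trans hx'.2.2)
    rw [this]
  · rintro _ ⟨w, rfl⟩
    exact isPathConnected_slice hc hne w
  · refine ⟨splitHomeomorph.toOpenPartialHomeomorph.restrOpen (cylinder D) (isOpen_cylinder hD),
      ⟨trivial, hx⟩, fun y hy => hy.2, contDiff_splitHomeomorph.contDiffOn,
      contDiff_splitHomeomorph_symm.contDiffOn, ?_⟩
    rintro _ ⟨w, rfl⟩ y ⟨hy, -⟩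
    have e1 : slice D w ∩ (splitHomeomorph.toOpenPartialHomeomorph.restrOpen (cylinder D)
        (isOpen_cylinder hD)).source = slice D w :=
      Set.inter_eq_left.2 fun z hz => ⟨trivial, hz.1⟩
    rw [e1]
    refine (Set.Subset.antisymm pathComponentIn_subset
      ((isPathConnected_slice hc hne w).subset_pathComponentIn hy subset_rfl)).trans ?_
    ext z
    constructor
    · rintro ⟨h1, h2, h3⟩
      refine ⟨⟨trivial, h1⟩, ?_⟩
      change ![z 2, z 3] = ![y 2, y 3]
      rw [h2, h3, hy.2.1, hy.2.2]
    · rintro ⟨⟨-, h1⟩, h2⟩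
      change ![z 2, z 3] = ![y 2, y 3] at h2
      exact ⟨h1, (congrFun h2 0).trans hy.2.1, (congrFun h2 1).trans hy.2.2⟩

/-- A slice is totally geodesic because the Christoffel symbols with fibre upper index and base
lower indices vanish. -/
theorem isTotallyGeodesic_slice (hD : IsOpen D) (hT : DifferentiableOn ℂ T D)
    (hpos : ∀ z ∈ D, 0 < (T z).im) (w : ℝ × ℝ) :
    IsTotallyGeodesic 2 (ghMetric T) (slice D w) := by
  intro V f hV hf hinj hmaps x hx a b
  have hfx : DifferentiableAt ℝ f x :=
    (hf.contDiffAt (hV.mem_nhds hx)).differentiableAt (by simp)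
  have hcomp : ∀ k v, fderiv ℝ f x v k = fderiv ℝ (fun y => f y k) x v := fun k v => by
    rw [fderiv_pi (differentiableAt_pi.1 hfx)]
    rfl
  have hfib : ∀ k : Fin 4, (∃ r, ∀ y ∈ V, f y k = r) → ∀ y ∈ V, fderiv ℝ (fun y => f y k) y = 0 := by
    rintro k ⟨r, hr⟩ y hy
    have : (fun y => f y k) =ᶠ[nhds y] fun _ => r :=
      Filter.eventually_of_mem (hV.mem_nhds hy) hr
    rw [this.fderiv_eq, fderiv_fun_const]
    rfl
  have h2 := hfib 2 ⟨w.1, fun y hy => (hmaps hy).2.1⟩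
  have h3 := hfib 3 ⟨w.2, fun y hy => (hmaps hy).2.2⟩
  have hpp : ∀ k : Fin 4, (∀ y ∈ V, fderiv ℝ (fun y => f y k) y = 0) →
      pd a (pd b (fun y => f y k)) x = 0 := fun k hk => by
    rw [pd_congr (g := fun _ => 0) hV (fun y hy => by simp [pd, hk y hy]) hx]
    simp [pd]
  -- the tangent space of the slice is the base plane, by dimension
  let N : Coord 2 →ₗ[ℝ] Coord 2 :=
    { toFun := fun v => ![fderiv ℝ f x v 0, fderiv ℝ f x v 1]
      map_add' := fun u v => by ext i; fin_cases i <;> simp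
      map_smul' := fun c v => by ext i; fin_cases i <;> simp }
  have hN : Function.Injective N := by
    refine fun u v huv => hinj x hx ?_
    ext k
    fin_cases k
    · exact congrFun huv 0
    · exact congrFun huv 1
    · change fderiv ℝ f x u 2 = fderiv ℝ f x v 2
      rw [hcomp, hcomp, h2 x hx]; rfl
    · change fderiv ℝ f x u 3 = fderiv ℝ f x v 3
      rw [hcomp, hcomp, h3 x hx]; rfl
  obtain ⟨v, hv⟩ := LinearMap.injective_iff_surjective.1 hN
    ![covDerivAlong (ghMetric T) f a b x 0, covDerivAlong (ghMetric T) f a b x 1]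
  have hmem := hmaps hx
  have hGam := christoffel_ghMetric ((hT.differentiableAt (hD.mem_nhds hmem.1)).hasDerivAt)
    (hpos _ hmem.1).ne'
  have hd2 : ∀ c, pd c (fun y => f y 2) x = 0 := fun c => by rw [pd, h2 x hx]; rfl
  have hd3 : ∀ c, pd c (fun y => f y 3) x = 0 := fun c => by rw [pd, h3 x hx]; rfl
  refine ⟨v, ?_⟩
  ext k
  fin_cases k
  · exact congrFun hv 0
  · exact congrFun hv 1
  · change fderiv ℝ f x v 2 = _
    rw [hcomp, h2 x hx]
    simp [covDerivAlong, hpp 2 h2, hGam, Fin.sum_univ_four, hd2, hd3, ghGamma]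
  · change fderiv ℝ f x v 3 = _
    rw [hcomp, h3 x hx]
    simp [covDerivAlong, hpp 3 h3, hGam, Fin.sum_univ_four, hd2, hd3, ghGamma]

/-- The metric induced by `ghMetric T` on a slice is `Im T |dz|²`. -/
theorem isIsometricLeaf_slice {U : Set (Coord 2)} {f : Coord 2 → ℂ} {γ : MatField 2}
    (hf : ContDiffOn ℝ ∞ f U) (hbij : Set.BijOn f U D)
    (hγ : ∀ x ∈ U, ∀ a b, (T (f x)).im *
      (pd a (fun y => (f y).re) x * pd b (fun y => (f y).re) x
        + pd a (fun y => (f y).im) x * pd b (fun y => (f y).im) x) = γ x a b) (w : ℝ × ℝ) :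
    IsIsometricLeaf (ghMetric T) (slice D w) γ U := by
  refine ⟨fun x => embed w (f x), (contDiff_embed w).comp_contDiffOn hf, ?_, fun x hx a b => ?_⟩
  · rw [← image_embed]
    refine Set.BijOn.comp (t := D) (Set.InjOn.bijOn_image fun z _ z' _ h => ?_) hbij
    rw [← plane_embed w z, h, plane_embed]
  · rw [← hγ x hx a b]
    have h2 : ∀ c, pd c (fun y => embed w (f y) 2) x = 0 := fun c => by simp [embed, pd]
    have h3 : ∀ c, pd c (fun y => embed w (f y) 3) x = 0 := fun c => by simp [embed, pd]
    have h0 : ∀ c, pd c (fun y => embed w (f y) 0) x = pd c (fun y => (f y).re) x := fun c => rfl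
    have h1 : ∀ c, pd c (fun y => embed w (f y) 1) x = pd c (fun y => (f y).im) x := fun c => rfl
    simp only [Fin.sum_univ_four, h0, h1, h2, h3]
    simp [ghMetric, plane_embed]
    ring

open Classical in
/-- The coordinate field `∂ᵢ` on `M`, extended by zero. -/
def coordField (M : Set (Coord 4)) (i : Fin 4) : Coord 4 → Coord 4 := fun x =>
  if x ∈ M then Pi.single i 1 else 0

theorem coordField_mem_killingFields (hD : IsOpen D) (hT : DifferentiableOn ℂ T D)
    (hpos : ∀ z ∈ D, 0 < (T z).im) {i : Fin 4} (hi : planeVec i = 0) :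
    coordField (cylinder D) i ∈ killingFields (ghMetric T) (cylinder D) := by
  have hev : ∀ x ∈ cylinder D, coordField (cylinder D) i =ᶠ[nhds x] fun _ => Pi.single i 1 :=
    fun x hx => Filter.eventually_of_mem ((isOpen_cylinder hD).mem_nhds hx)
      fun y hy => if_pos hy
  refine ⟨fun x hx => contDiffAt_const.congr_of_eventuallyEq (hev x hx), fun x hx => if_neg hx,
    fun x hx a b => ?_⟩
  have hX : ∀ c k, pd c (fun y => coordField (cylinder D) i y k) x = 0 := fun c k => by
    rw [pd_congr (g := fun _ => (Pi.single i 1 : Coord 4) k) (isOpen_cylinder hD)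
      (fun y hy => by rw [coordField, if_pos hy]) hx]
    simp [pd]
  have hg : pd i (fun y => ghMetric T y a b) x = 0 := by
    rw [(hasPd_ghMetric ((hT.differentiableAt (hD.mem_nhds hx)).hasDerivAt) (hpos _ hx).ne'
      i a b).2, hi]
    fin_cases a <;> fin_cases b <;> simp [ghMetricDeriv]
  refine Finset.sum_eq_zero fun k _ => ?_
  rw [hX, hX]
  by_cases hk : k = i
  · subst hk
    simp [hg]
  · simp [coordField, if_pos hx, hk]

theorem two_le_rank_killingFields (hD : IsOpen D) (hne : D.Nonempty) (hT : DifferentiableOn ℂ T D)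
    (hpos : ∀ z ∈ D, 0 < (T z).im) :
    2 ≤ Module.rank ℝ (killingFields (ghMetric T) (cylinder D)) := by
  obtain ⟨z, hz⟩ := hne
  have hx : embed (0, 0) z ∈ cylinder D := by rwa [cylinder, Set.mem_preimage, plane_embed]
  let X : Fin 2 → killingFields (ghMetric T) (cylinder D) :=
    ![⟨_, coordField_mem_killingFields hD hT hpos (i := 2) rfl⟩,
      ⟨_, coordField_mem_killingFields hD hT hpos (i := 3) rfl⟩]
  have hX : LinearIndependent ℝ X := by
    rw [LinearIndependent.pair_iff]
    intro s t hst
    have h := congrFun (congrArg Subtype.val hst) (embed (0, 0) z)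
    have h2 := congrFun h 2
    have h3 := congrFun h 3
    simp [coordField, if_pos hx] at h2 h3
    exact ⟨h2, h3⟩
  simpa using hX.cardinal_le_rank

/-- The geometry of the Gibbons-Hawking structure of a holomorphic function on a convex domain. -/
theorem exists_foliated_ricciFlat_kahler {U : Set (Coord 2)} {f : Coord 2 → ℂ} {γ : MatField 2}
    (hD : IsOpen D) (hc : Convex ℝ D) (hne : D.Nonempty) (hT : DifferentiableOn ℂ T D)
    (hpos : ∀ z ∈ D, 0 < (T z).im) (hf : ContDiffOn ℝ ∞ f U) (hbij : Set.BijOn f U D)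
    (hγ : ∀ x ∈ U, ∀ a b, (T (f x)).im *
      (pd a (fun y => (f y).re) x * pd b (fun y => (f y).re) x
        + pd a (fun y => (f y).im) x * pd b (fun y => (f y).im) x) = γ x a b) :
    ∃ (M : Set (Coord 4)) (g J : MatField 4) (𝓛 : Set (Set (Coord 4))),
      IsOpen M ∧ IsConnected M ∧ IsKahlerOn g J M ∧ IsRicciFlatOn g M ∧
      IsFoliationOn 2 2 M 𝓛 ∧ (∀ L ∈ 𝓛, IsTotallyGeodesic 2 g L) ∧
      (∀ L ∈ 𝓛, IsIsometricLeaf g L γ U) ∧ 2 ≤ Module.rank ℝ (killingFields g M) := by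
  refine ⟨cylinder D, ghMetric T, ghComplexStructure T, Set.range (slice D), isOpen_cylinder hD,
    ?_, isKahlerOn_gh hD hT hpos, isRicciFlatOn_ghMetric hD hT hpos,
    isFoliationOn_slice hD hc hne, ?_, ?_, two_le_rank_killingFields hD hne hT hpos⟩
  · obtain ⟨z, hz⟩ := hne
    refine (hc.linear_preimage plane.toLinearMap).isConnected ⟨embed (0, 0) z, ?_⟩
    change plane (embed (0, 0) z) ∈ D
    rwa [plane_embed]
  · rintro _ ⟨w, rfl⟩
    exact isTotallyGeodesic_slice hD hT hpos w
  · rintro _ ⟨w, rfl⟩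
    exact isIsometricLeaf_slice hf hbij hγ w

end Leaves

/-! ### Second-order linear equations in the complex domain -/

theorem summable_norm_powerSeries {c : ℕ → ℂ} {r K : ℝ} (hr : 0 < r)
    (hb : ∀ n, ‖c n‖ * r ^ n ≤ K) {w : ℂ} (hw : ‖w‖ < r) : Summable fun n => ‖c n * w ^ n‖ := by
  have hq : ‖w‖ / r < 1 := (div_lt_one hr).2 hw
  refine Summable.of_nonneg_of_le (fun n => norm_nonneg _) (fun n => ?_)
    ((summable_geometric_of_lt_one (by positivity) hq).mul_left K)
  rw [norm_mul, norm_pow, div_pow, mul_div_assoc', le_div_iff₀ (by positivity)]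
  calc ‖c n‖ * ‖w‖ ^ n * r ^ n = ‖c n‖ * r ^ n * ‖w‖ ^ n := by ring
    _ ≤ K * ‖w‖ ^ n := by gcongr; exact hb n

theorem hasDerivAt_powerSeries {c : ℕ → ℂ} {r K : ℝ} (hr : 0 < r)
    (hb : ∀ n, ‖c n‖ * r ^ n ≤ K) {z₀ z : ℂ} (hz : ‖z - z₀‖ < r) :
    HasDerivAt (fun z => ∑' n, c n * (z - z₀) ^ n)
      (∑' n, ((n + 1 : ℕ) * c (n + 1)) * (z - z₀) ^ n) z := by
  obtain ⟨s, hzs, hsr⟩ := exists_between hz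
  have hs : 0 < s := (norm_nonneg _).trans_lt hzs
  have hq : s / r < 1 := (div_lt_one hr).2 hsr
  have hK : 0 ≤ K := le_trans (by positivity) (hb 0)
  have hq' : ‖s / r‖ < 1 := by rwa [Real.norm_of_nonneg (div_pos hs hr).le]
  have hu : Summable fun n : ℕ => K / s * ((n : ℝ) ^ 1 * (s / r) ^ n) :=
    (summable_pow_mul_geometric_of_norm_lt_one 1 hq').mul_left _
  have hbound : ∀ (n : ℕ) (w : ℂ), w ∈ Metric.ball z₀ s →
      ‖c n * (n * (w - z₀) ^ (n - 1))‖ ≤ K / s * ((n : ℝ) ^ 1 * (s / r) ^ n) := by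
    intro n w hw
    rw [mem_ball_iff_norm] at hw
    rcases n with _ | n
    · simp
    rw [norm_mul, norm_mul, norm_pow, Complex.norm_natCast, Nat.add_sub_cancel, pow_one, div_pow]
    have h1 : ‖c (n + 1)‖ ≤ K / r ^ (n + 1) := by
      rw [le_div_iff₀ (by positivity)]; exact hb _
    calc ‖c (n + 1)‖ * (((n + 1 : ℕ) : ℝ) * ‖w - z₀‖ ^ n)
        ≤ K / r ^ (n + 1) * (((n + 1 : ℕ) : ℝ) * s ^ n) := by gcongr
      _ = K / s * (((n + 1 : ℕ) : ℝ) * (s ^ (n + 1) / r ^ (n + 1))) := by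
        rw [pow_succ s]
        field_simp
  have hz' : z ∈ Metric.ball z₀ s := by rwa [mem_ball_iff_norm]
  have h := hasDerivAt_tsum_of_isPreconnected (g := fun n z => c n * (z - z₀) ^ n)
    (g' := fun n z => c n * (n * (z - z₀) ^ (n - 1))) hu Metric.isOpen_ball
    (convex_ball z₀ s).isPreconnected (fun n w _ => ?_) hbound hz'
    (summable_norm_powerSeries hr hb hz).of_norm hz'
  · refine h.congr_deriv ?_
    have hs' : Summable fun n : ℕ => c n * (n * (z - z₀) ^ (n - 1)) :=
      Summable.of_norm_bounded hu fun n => hbound n z hz'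
    rw [hs'.tsum_eq_zero_add]
    simp only [Nat.cast_zero, zero_mul, mul_zero, zero_add, Nat.add_sub_cancel]
    exact tsum_congr fun n => by ring
  · simpa using (((hasDerivAt_id w).sub_const z₀).pow n).const_mul (c n)

/-- The Taylor coefficients of the solution of `y'' = q y` with initial values `y₀`, `y₁`. -/
def odeCoeff (q : ℕ → ℂ) (y₀ y₁ : ℂ) : ℕ → ℂ
  | 0 => y₀
  | 1 => y₁
  | n + 2 => (∑ k : Fin (n + 1), q k * odeCoeff q y₀ y₁ (n - k)) / ((n + 2 : ℕ) * (n + 1 : ℕ))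
  termination_by n => n

/-- For small `r`, the division by `(n + 2) (n + 1)` outweighs the `n + 1` terms of the recursion. -/
theorem odeCoeff_bound {q : ℕ → ℂ} (y₀ y₁ : ℂ) {r C : ℝ} (hr : 0 < r)
    (hq : ∀ n, ‖q n‖ * r ^ n ≤ C) (hC : C * r ^ 2 ≤ 1) (n : ℕ) :
    ‖odeCoeff q y₀ y₁ n‖ * r ^ n ≤ max ‖y₀‖ (‖y₁‖ * r) := by
  set K := max ‖y₀‖ (‖y₁‖ * r)
  have hK : 0 ≤ K := (norm_nonneg y₀).trans (le_max_left _ _)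
  have hC0 : 0 ≤ C := (by positivity : 0 ≤ ‖q 0‖ * r ^ 0).trans (hq 0)
  induction n using Nat.strong_induction_on with
  | _ n ih =>
    match n with
    | 0 => simp [odeCoeff, K]
    | 1 => simp [odeCoeff, K]
    | n + 2 =>
      rw [odeCoeff, norm_div, norm_mul, Complex.norm_natCast, Complex.norm_natCast]
      have h1 : ‖∑ k : Fin (n + 1), q k * odeCoeff q y₀ y₁ (n - k)‖ * r ^ n
          ≤ ((n + 1 : ℕ) : ℝ) * (C * K) := by
        calc _ ≤ (∑ k : Fin (n + 1), ‖q k * odeCoeff q y₀ y₁ (n - k)‖) * r ^ n := by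
              gcongr; exact norm_sum_le _ _
          _ = ∑ k : Fin (n + 1), ‖q k * odeCoeff q y₀ y₁ (n - k)‖ * r ^ n := Finset.sum_mul ..
          _ ≤ ∑ k : Fin (n + 1), C * K := by
              refine Finset.sum_le_sum fun k _ => ?_
              have hk : (k : ℕ) + (n - k) = n := by omega
              have hp : r ^ n = r ^ (k : ℕ) * r ^ (n - k) := by rw [← pow_add, hk]
              rw [norm_mul, hp]
              calc _ = (‖q k‖ * r ^ (k : ℕ)) * (‖odeCoeff q y₀ y₁ (n - k)‖ * r ^ (n - k)) := by ring
                _ ≤ C * K := by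
                  gcongr
                  · exact hq k
                  · exact ih _ (by omega)
          _ = _ := by simp
      rw [div_mul_eq_mul_div, div_le_iff₀ (by positivity)]
      calc _ = (‖∑ k : Fin (n + 1), q k * odeCoeff q y₀ y₁ (n - k)‖ * r ^ n) * r ^ 2 := by ring
        _ ≤ (((n + 1 : ℕ) : ℝ) * (C * K)) * r ^ 2 := by gcongr
        _ = (C * r ^ 2) * (((n + 1 : ℕ) : ℝ) * K) := by ring
        _ ≤ 1 * (((n + 1 : ℕ) : ℝ) * K) := by gcongr
        _ ≤ ((n + 2 : ℕ) : ℝ) * (((n + 1 : ℕ) : ℝ) * K) := by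
          gcongr
          exact_mod_cast Nat.one_le_iff_ne_zero.2 (by omega)
        _ = K * (((n + 2 : ℕ) : ℝ) * ((n + 1 : ℕ) : ℝ)) := by ring

/-- Local solvability of `y'' = q y` for holomorphic `q`. -/
theorem exists_hasDerivAt_second_order {q : ℂ → ℂ} {z₀ : ℂ} {R : ℝ} (hR : 0 < R)
    (hq : DifferentiableOn ℂ q (Metric.ball z₀ R)) (y₀ y₁ : ℂ) :
    ∃ r > 0, r ≤ R ∧ ∃ y y' : ℂ → ℂ, y z₀ = y₀ ∧ y' z₀ = y₁ ∧
      ∀ z ∈ Metric.ball z₀ r, HasDerivAt y (y' z) z ∧ HasDerivAt y' (q z * y z) z := by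
  let a : ℕ → ℂ := fun n => (n.factorial : ℂ)⁻¹ * iteratedDeriv n q z₀
  have ha : ∀ z ∈ Metric.ball z₀ R, HasSum (fun n => a n * (z - z₀) ^ n) (q z) := fun z hz => by
    have := Complex.hasSum_taylorSeries_on_ball hq hz
    refine this.congr_fun ?_
    intro n
    simp [a, smul_eq_mul]
    ring
  -- boundedness of the terms at a point at distance `R / 2`
  obtain ⟨C, hC⟩ : ∃ C, ∀ n, ‖a n‖ * (R / 2) ^ n ≤ C := by
    have hz : z₀ + (R / 2 : ℝ) ∈ Metric.ball z₀ R := by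
      rw [mem_ball_iff_norm, add_sub_cancel_left, Complex.norm_real,
        Real.norm_of_nonneg (by positivity)]
      linarith
    have h := (ha _ hz).summable.tendsto_atTop_zero.norm.bddAbove_range
    obtain ⟨C, hC⟩ := h
    refine ⟨C, fun n => ?_⟩
    have := hC ⟨n, rfl⟩
    simpa [norm_mul, norm_pow, abs_of_pos hR] using this
  have hC0 : 0 ≤ C := (by positivity : 0 ≤ ‖a 0‖ * (R / 2) ^ 0).trans (hC 0)
  -- `C ρ² ≤ 1` makes the recursion for the coefficients stable
  let ρ : ℝ := min (R / 2) (1 / (C + 1))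
  have hρ : 0 < ρ := lt_min (by positivity) (by positivity)
  have haρ : ∀ n, ‖a n‖ * ρ ^ n ≤ C := fun n => by
    refine le_trans ?_ (hC n)
    gcongr
    exact min_le_left _ _
  have hCρ : C * ρ ^ 2 ≤ 1 := by
    have h1 : ρ * (C + 1) ≤ 1 := (le_div_iff₀ (by positivity)).1 (min_le_right _ _)
    have h2 : ρ ≤ 1 := (min_le_right _ _).trans (by
      rw [div_le_one (by positivity)]; linarith)
    nlinarith
  let c := odeCoeff a y₀ y₁
  set K := max ‖y₀‖ (‖y₁‖ * ρ)
  have hc : ∀ n, ‖c n‖ * ρ ^ n ≤ K := odeCoeff_bound y₀ y₁ hρ haρ hCρ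
  have hd : ∀ n : ℕ, ‖((n + 1 : ℕ) : ℂ) * c (n + 1)‖ * (ρ / 2) ^ n ≤ K / ρ := fun n => by
    rw [norm_mul, Complex.norm_natCast, div_pow, le_div_iff₀ hρ]
    have h2 : ((n + 1 : ℕ) : ℝ) / 2 ^ n ≤ 1 := by
      rw [div_le_one (by positivity)]
      exact_mod_cast Nat.lt_two_pow_self
    calc _ = ((n + 1 : ℕ) : ℝ) / 2 ^ n * (‖c (n + 1)‖ * ρ ^ (n + 1)) := by
          rw [pow_succ]; field_simp
      _ ≤ 1 * K := by gcongr; exact hc _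
      _ = K := one_mul K
  refine ⟨ρ / 2, by positivity, ?_, fun z => ∑' n, c n * (z - z₀) ^ n,
    fun z => ∑' n : ℕ, ((n + 1 : ℕ) * c (n + 1)) * (z - z₀) ^ n, ?_, ?_, fun z hz => ?_⟩
  · have : ρ ≤ R / 2 := min_le_left _ _
    linarith
  · simp only [sub_self]
    rw [tsum_eq_single 0 fun n hn => by simp [hn]]
    simp [c, odeCoeff]
  · simp only [sub_self]
    rw [tsum_eq_single 0 fun n hn => by simp [hn]]
    simp [c, odeCoeff]
  · rw [mem_ball_iff_norm] at hz
    have hzρ : ‖z - z₀‖ < ρ := by linarith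
    refine ⟨hasDerivAt_powerSeries hρ hc hzρ, ?_⟩
    have h := hasDerivAt_powerSeries (by positivity) hd hz
    refine h.congr_deriv (Eq.symm ?_)
    have hzR : z ∈ Metric.ball z₀ R := by
      have : ρ ≤ R / 2 := min_le_left _ _
      rw [mem_ball_iff_norm]; linarith
    rw [← (ha z hzR).tsum_eq, tsum_mul_tsum_eq_tsum_sum_range_of_summable_norm
      (summable_norm_powerSeries hρ haρ hzρ) (summable_norm_powerSeries hρ hc hzρ)]
    refine tsum_congr fun n => ?_
    have hn : c (n + 2) = (∑ k ∈ Finset.range (n + 1), a k * c (n - k)) /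
        ((n + 2 : ℕ) * (n + 1 : ℕ)) := by
      rw [Finset.sum_range]
      simp only [c]
      rw [odeCoeff]
    have h1 : ((n + 2 : ℕ) : ℂ) ≠ 0 := Nat.cast_ne_zero.2 (by omega)
    have h2 : ((n + 1 : ℕ) : ℂ) ≠ 0 := Nat.cast_ne_zero.2 (by omega)
    change _ = ((n + 1 : ℕ) : ℂ) * (((n + 2 : ℕ) : ℂ) * c (n + 2)) * (z - z₀) ^ n
    rw [hn, show ∀ s : ℂ, ((n + 1 : ℕ) : ℂ) * (((n + 2 : ℕ) : ℂ) * (s / (((n + 2 : ℕ) : ℂ) *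
      ((n + 1 : ℕ) : ℂ)))) = s from fun s => by field_simp, Finset.sum_mul]
    refine Finset.sum_congr rfl fun k hk => ?_
    have hk' : k + (n - k) = n := by have := Finset.mem_range.1 hk; omega
    calc _ = a k * c (n - k) * ((z - z₀) ^ k * (z - z₀) ^ (n - k)) := by ring
      _ = _ := by rw [← pow_add, hk']

/-! ### Wirtinger derivatives -/

open ComplexConjugate

/-- The real-linear map `w ↦ a w + b w̄`. -/
def wirt (a b : ℂ) : ℂ →L[ℝ] ℂ :=
  a • ContinuousLinearMap.id ℝ ℂ + b • (Complex.conjCLE : ℂ →L[ℝ] ℂ)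

@[simp] theorem wirt_apply (a b w : ℂ) : wirt a b w = a * w + b * conj w := by
  simp [wirt]

theorem wirt_injective {a b a' b' : ℂ} (h : wirt a b = wirt a' b') : a = a' ∧ b = b' := by
  have h1 := DFunLike.congr_fun h 1
  have h2 := DFunLike.congr_fun h Complex.I
  simp only [wirt_apply, map_one, mul_one, Complex.conj_I] at h1 h2
  have h3 : a - b = a' - b' := by
    apply mul_right_cancel₀ Complex.I_ne_zero
    linear_combination h2
  exact ⟨by linear_combination (h1 + h3) / 2, by linear_combination (h1 - h3) / 2⟩

theorem eq_wirt (L : ℂ →L[ℝ] ℂ) :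
    L = wirt ((L 1 - Complex.I * L Complex.I) / 2) ((L 1 + Complex.I * L Complex.I) / 2) := by
  ext w
  have e1 : w = w.re + w.im * Complex.I := (Complex.re_add_im w).symm
  have e2 : conj w = w.re - w.im * Complex.I := by apply Complex.ext <;> simp
  have hw : L w = w.re * L 1 + w.im * L Complex.I := by
    have h := L.map_add (w.re • (1 : ℂ)) (w.im • Complex.I)
    rw [L.map_smul, L.map_smul] at h
    simpa using h
  rw [wirt_apply, hw]
  linear_combination -((L 1 - Complex.I * L Complex.I) / 2) * e1
    - ((L 1 + Complex.I * L Complex.I) / 2) * e2 + (w.im * L Complex.I) * Complex.I_mul_I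

/-- `f` is real differentiable at `z` with Wirtinger derivatives `∂f/∂z = a` and
`∂f/∂z̄ = b`. -/
def HasWirt (f : ℂ → ℂ) (a b z : ℂ) : Prop := HasFDerivAt f (wirt a b) z

section HasWirt

variable {f g : ℂ → ℂ} {a b c d z : ℂ}

theorem HasWirt.unique (h : HasWirt f a b z) (h' : HasWirt f c d z) : a = c ∧ b = d :=
  wirt_injective (HasFDerivAt.unique h h')

theorem HasWirt.congr_val (h : HasWirt f a b z) (ha : a = c) (hb : b = d) : HasWirt f c d z :=
  ha ▸ hb ▸ h

theorem HasWirt.congr (h : HasWirt f a b z) (hg : g =ᶠ[nhds z] f) : HasWirt g a b z :=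
  HasFDerivAt.congr_of_eventuallyEq h hg

theorem hasWirt_const (k : ℂ) : HasWirt (fun _ => k) 0 0 z :=
  (hasFDerivAt_const k z).congr_fderiv (by ext; simp)

theorem HasWirt.sub (hf : HasWirt f a b z) (hg : HasWirt g c d z) :
    HasWirt (fun w => f w - g w) (a - c) (b - d) z :=
  (HasFDerivAt.fun_sub hf hg).congr_fderiv (by ext; simp; ring)

theorem HasWirt.mul (hf : HasWirt f a b z) (hg : HasWirt g c d z) :
    HasWirt (fun w => f w * g w) (a * g z + f z * c) (b * g z + f z * d) z :=
  (HasFDerivAt.fun_mul hf hg).congr_fderiv (by ext; simp; ring)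

theorem HasWirt.conj (hf : HasWirt f a b z) :
    HasWirt (fun w => conj (f w)) (conj b) (conj a) z :=
  ((Complex.conjCLE : ℂ →L[ℝ] ℂ).hasFDerivAt.comp z hf).congr_fderiv (by ext; simp; ring)

theorem _root_.HasDerivAt.hasWirt (h : HasDerivAt f a z) : HasWirt f a 0 z :=
  (h.hasFDerivAt.restrictScalars ℝ).congr_fderiv (by ext; simp [mul_comm])

theorem HasWirt.hasDerivAt (h : HasWirt f a b z) (hb : b = 0) : HasDerivAt f a z := by
  subst hb
  rw [hasDerivAt_iff_hasFDerivAt]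
  refine hasFDerivAt_of_restrictScalars ℝ h ?_
  ext
  simp [mul_comm]

theorem HasWirt.div (hf : HasWirt f a b z) (hg : HasWirt g c d z) (h0 : g z ≠ 0) :
    HasWirt (fun w => f w / g w) ((a * g z - f z * c) / g z ^ 2) ((b * g z - f z * d) / g z ^ 2)
      z := by
  have hi : HasWirt (fun w => (g w)⁻¹) (-c / g z ^ 2) (-d / g z ^ 2) z := by
    have h1 := ((hasDerivAt_inv h0).hasFDerivAt.restrictScalars ℝ).comp z hg
    refine HasFDerivAt.congr_fderiv h1 ?_
    ext
    simp
    ring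
  have h : HasWirt (fun w => f w * (g w)⁻¹) _ _ z := hf.mul hi
  simp only [← div_eq_mul_inv] at h
  refine h.congr_val ?_ ?_ <;> field_simp <;> ring

end HasWirt

/-- The Wirtinger derivative `∂f/∂z`. -/
def dz (f : ℂ → ℂ) (z : ℂ) : ℂ := (fderiv ℝ f z 1 - Complex.I * fderiv ℝ f z Complex.I) / 2

/-- The Wirtinger derivative `∂f/∂z̄`. -/
def dzbar (f : ℂ → ℂ) (z : ℂ) : ℂ := (fderiv ℝ f z 1 + Complex.I * fderiv ℝ f z Complex.I) / 2

theorem _root_.DifferentiableAt.hasWirt {f : ℂ → ℂ} {z : ℂ} (h : DifferentiableAt ℝ f z) :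
    HasWirt f (dz f z) (dzbar f z) z :=
  h.hasFDerivAt.congr_fderiv (eq_wirt _)

section Smooth

variable {f : ℂ → ℂ} {D : Set ℂ}

theorem contDiffOn_dz (hD : IsOpen D) (hf : ContDiffOn ℝ ∞ f D) : ContDiffOn ℝ ∞ (dz f) D :=
  ((contDiffOn_fderiv_apply hD hf 1).sub
    (contDiffOn_const.mul (contDiffOn_fderiv_apply hD hf Complex.I))).div_const 2

theorem contDiffOn_dzbar (hD : IsOpen D) (hf : ContDiffOn ℝ ∞ f D) : ContDiffOn ℝ ∞ (dzbar f) D :=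
  ((contDiffOn_fderiv_apply hD hf 1).add
    (contDiffOn_const.mul (contDiffOn_fderiv_apply hD hf Complex.I))).div_const 2

theorem hasWirt_of_contDiffOn (hD : IsOpen D) (hf : ContDiffOn ℝ ∞ f D) {z : ℂ} (hz : z ∈ D) :
    HasWirt f (dz f z) (dzbar f z) z :=
  ((hf.contDiffAt (hD.mem_nhds hz)).differentiableAt (by simp)).hasWirt

/-- The mixed Wirtinger derivatives of a smooth function agree. -/
theorem dzbar_dz (hD : IsOpen D) (hf : ContDiffOn ℝ ∞ f D) {z : ℂ} (hz : z ∈ D) :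
    dzbar (dz f) z = dz (dzbar f) z := by
  have hs := isSymmSndFDerivAt_of_contDiffOn hD hf hz
  have h := hasFDerivAt_fderiv_apply hD hf hz
  have h1 : HasFDerivAt (dz f) _ z :=
    (((h 1).sub ((h Complex.I).const_mul Complex.I)).mul_const (2⁻¹ : ℂ)).congr_of_eventuallyEq
      (Filter.Eventually.of_forall fun w => by simp [dz, div_eq_mul_inv])
  have h2 : HasFDerivAt (dzbar f) _ z :=
    (((h 1).add ((h Complex.I).const_mul Complex.I)).mul_const (2⁻¹ : ℂ)).congr_of_eventuallyEq
      (Filter.Eventually.of_forall fun w => by simp [dzbar, div_eq_mul_inv])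
  have hs' := hs.eq Complex.I 1
  rw [dzbar, dz, h1.fderiv, h2.fderiv]
  simp
  rw [hs']
  ring

end Smooth

/-- The Wirtinger derivatives of a real function are conjugate. -/
theorem dzbar_ofReal {f : ℂ → ℝ} {z : ℂ} (hf : DifferentiableAt ℝ f z) :
    dzbar (fun w => (f w : ℂ)) z = conj (dz (fun w => (f w : ℂ)) z) := by
  have h : HasFDerivAt (fun w => (f w : ℂ)) (Complex.ofRealCLM.comp (fderiv ℝ f z)) z :=
    Complex.ofRealCLM.hasFDerivAt.comp z hf.hasFDerivAt
  simp [dzbar, dz, h.fderiv, map_ofNat (starRingEnd ℂ) 2]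

theorem eq_of_hasWirt_zero {D : Set ℂ} (hD : IsOpen D) (hc : Convex ℝ D) {f : ℂ → ℂ}
    (hf : ∀ z ∈ D, HasWirt f 0 0 z) {x y : ℂ} (hx : x ∈ D) (hy : y ∈ D) : f x = f y := by
  refine hD.is_const_of_fderiv_eq_zero hc.isPreconnected
    (fun z hz => (hf z hz).differentiableAt.differentiableWithinAt) (fun z hz => ?_) hx hy
  have h : HasFDerivAt f (wirt 0 0) z := hf z hz
  rw [h.fderiv]
  ext
  simp

/-- A real function on a convex domain whose derivative `∂v/∂z = g` is holomorphic is the real part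
of a holomorphic function. -/
theorem exists_re_eq {D : Set ℂ} (hD : IsOpen D) (hc : Convex ℝ D) {v : ℂ → ℝ} {g : ℂ → ℂ}
    (hg : DifferentiableOn ℂ g D)
    (hv : ∀ z ∈ D, HasWirt (fun w => (v w : ℂ)) (g z) (conj (g z)) z) :
    ∃ F : ℂ → ℂ, (∀ z ∈ D, HasDerivAt F (2 * g z) z) ∧ ∀ z ∈ D, (F z).re = v z := by
  rcases D.eq_empty_or_nonempty with rfl | ⟨c, hcD⟩
  · exact ⟨0, by simp, by simp⟩
  obtain ⟨F, hF⟩ := hc.exists_forall_hasDerivWithinAt (hg.const_mul 2)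
  have hF' : ∀ z ∈ D, HasDerivAt F (2 * g z) z := fun z hz => (hF z hz).hasDerivAt (hD.mem_nhds hz)
  have hre : ∀ w : ℂ, (w.re : ℂ) = 1 / 2 * (w - -conj w) := fun w => by
    rw [sub_neg_eq_add, Complex.add_conj]; push_cast; ring
  have hk : ∀ z ∈ D, HasWirt (fun w => (v w : ℂ) - ((F w).re : ℂ)) 0 0 z := fun z hz => by
    have h1 := (hF' z hz).hasWirt
    have h2 := (hasWirt_const (z := z) (1 / 2)).mul (h1.sub ((hasWirt_const (z := z) 0).sub h1.conj))
    refine ((hv z hz).sub (g := fun w => ((F w).re : ℂ))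
      (h2.congr (Filter.Eventually.of_forall fun w => ?_))).congr_val ?_ ?_
    · simp only [hre, zero_sub]
    · simp
    · simp [map_ofNat (starRingEnd ℂ) 2]
  refine ⟨fun z => F z + ((v c - (F c).re : ℝ) : ℂ), fun z hz => (hF' z hz).add_const _,
    fun z hz => ?_⟩
  have h := eq_of_hasWirt_zero hD hc hk hz hcD
  norm_cast at h
  simp only [Complex.add_re, Complex.ofReal_re]
  linarith

/-- A real harmonic function on a convex plane domain is the real part of a holomorphic function. -/
theorem exists_re_eq_of_harmonic {D : Set ℂ} (hD : IsOpen D) (hc : Convex ℝ D) {v : ℂ → ℝ}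
    (hv : ContDiffOn ℝ ∞ v D) (hharm : ∀ z ∈ D, dzbar (dz fun w => (v w : ℂ)) z = 0) :
    ∃ F : ℂ → ℂ, DifferentiableOn ℂ F D ∧ ∀ z ∈ D, (F z).re = v z := by
  have hV : ContDiffOn ℝ ∞ (fun w => (v w : ℂ)) D := Complex.ofRealCLM.contDiff.comp_contDiffOn hv
  obtain ⟨F, h1, h2⟩ := exists_re_eq hD hc (v := v) (g := dz fun w => (v w : ℂ))
    (fun z hz => ((hasWirt_of_contDiffOn hD (contDiffOn_dz hD hV) hz).hasDerivAt
      (hharm z hz)).differentiableAt.differentiableWithinAt)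
    (fun z hz => (hasWirt_of_contDiffOn hD hV hz).congr_val rfl (dzbar_ofReal
      ((hv.contDiffAt (hD.mem_nhds hz)).differentiableAt (by simp))))
  exact ⟨F, fun z hz => (h1 z hz).differentiableAt.differentiableWithinAt, h2⟩

/-! ### Liouville's equation -/

/-- Derivatives of a solution of Liouville's equation `ψ ψ_{zz̄} - ψ_z ψ_z̄ = κ`, with `a = ψ_z`,
`m = ψ_{zz̄}`, `c = ψ_{zz}`, `n = ψ_{zzz̄}`. Differentiating the equation in `z` gives
`ψ n = c ā`. -/
theorem liouville_derivatives {D : Set ℂ} (hD : IsOpen D) {ψ : ℂ → ℝ} (hψ : ContDiffOn ℝ ∞ ψ D)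
    {κ : ℂ} (heq : ∀ z ∈ D, ψ z * dzbar (dz fun w => (ψ w : ℂ)) z
      - dz (fun w => (ψ w : ℂ)) z * conj (dz (fun w => (ψ w : ℂ)) z) = κ) :
    ∃ a m n c c' : ℂ → ℂ, ∀ z ∈ D, ψ z * m z - a z * conj (a z) = κ ∧
      HasWirt (fun w => (ψ w : ℂ)) (a z) (conj (a z)) z ∧ HasWirt a (c z) (m z) z ∧
      conj (m z) = m z ∧ HasWirt m (n z) (conj (n z)) z ∧ HasWirt c (c' z) (n z) z ∧
      ψ z * n z = c z * conj (a z) := by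
  have hV : ContDiffOn ℝ ∞ (fun w => (ψ w : ℂ)) D := Complex.ofRealCLM.contDiff.comp_contDiffOn hψ
  set a := dz fun w => (ψ w : ℂ)
  have ha : ContDiffOn ℝ ∞ a D := contDiffOn_dz hD hV
  set m := dzbar a
  have hm : ContDiffOn ℝ ∞ m D := contDiffOn_dzbar hD ha
  have hbar : ∀ z ∈ D, dzbar (fun w => (ψ w : ℂ)) z = conj (a z) := fun z hz =>
    dzbar_ofReal ((hψ.contDiffAt (hD.mem_nhds hz)).differentiableAt (by simp))
  have hψw : ∀ z ∈ D, HasWirt (fun w => (ψ w : ℂ)) (a z) (conj (a z)) z := fun z hz =>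
    (hasWirt_of_contDiffOn hD hV hz).congr_val rfl (hbar z hz)
  have haw : ∀ z ∈ D, HasWirt a (dz a z) (m z) z := fun z hz => hasWirt_of_contDiffOn hD ha hz
  have hmreal : ∀ z ∈ D, conj (m z) = m z := fun z hz => by
    have h2 : HasWirt (dzbar fun w => (ψ w : ℂ)) (conj (m z)) (conj (dz a z)) z :=
      (haw z hz).conj.congr (Filter.eventually_of_mem (hD.mem_nhds hz) hbar)
    exact (h2.unique h2.differentiableAt.hasWirt).1.trans (dzbar_dz hD hV hz).symm
  have hmw : ∀ z ∈ D, HasWirt m (dz m z) (conj (dz m z)) z := fun z hz => by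
    have h1 := hasWirt_of_contDiffOn hD hm hz
    have h2 : HasWirt m _ _ z := h1.conj.congr
      (Filter.eventually_of_mem (hD.mem_nhds hz) fun w hw => (hmreal w hw).symm)
    exact h1.congr_val rfl (h1.unique h2).2
  have hcw : ∀ z ∈ D, HasWirt (dz a) (dz (dz a) z) (dz m z) z := fun z hz =>
    (hasWirt_of_contDiffOn hD (contDiffOn_dz hD ha) hz).congr_val rfl (dzbar_dz hD ha hz)
  refine ⟨a, m, dz m, dz a, dz (dz a), fun z hz => ⟨heq z hz, hψw z hz, haw z hz, hmreal z hz,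
    hmw z hz, hcw z hz, ?_⟩⟩
  have h1 := ((hψw z hz).mul (hmw z hz)).sub ((haw z hz).mul (haw z hz).conj)
  have h2 := (hasWirt_const (z := z) κ).congr (Filter.eventually_of_mem (hD.mem_nhds hz) heq)
  have h3 := (h1.unique h2).1
  rw [hmreal z hz] at h3
  linear_combination h3

/-- Liouville's theorem: a positive solution of `ψ ψ_{zz̄} - ψ_z ψ_z̄ = -1/2` has locally the form
`ψ = Im τ |y|²` with `y`, `τ` holomorphic, `y` without zeros and `Im τ > 0`.

The function `y` solves the second-order equation `y'' = (ψ_{zz} / ψ) y`, whose potential is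
holomorphic. The initial values are such that `ψ_z y - ψ y' = -s ȳ`, `s² = 1/2`, at the centre to
first order, hence everywhere. Then `v = ψ / |y|²` satisfies `v_z = -s / y²`, so it is harmonic. -/
theorem exists_liouville_representation {D : Set ℂ} (hD : IsOpen D) {ψ : ℂ → ℝ}
    (hψ : ContDiffOn ℝ ∞ ψ D) (hpos : ∀ z ∈ D, 0 < ψ z)
    (heq : ∀ z ∈ D, ψ z * dzbar (dz fun w => (ψ w : ℂ)) z
      - dz (fun w => (ψ w : ℂ)) z * conj (dz (fun w => (ψ w : ℂ)) z) = -1 / 2)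
    {z₀ : ℂ} (hz₀ : z₀ ∈ D) :
    ∃ r > 0, Metric.ball z₀ r ⊆ D ∧ ∃ y τ : ℂ → ℂ, DifferentiableOn ℂ y (Metric.ball z₀ r) ∧
      DifferentiableOn ℂ τ (Metric.ball z₀ r) ∧ ∀ z ∈ Metric.ball z₀ r,
        y z ≠ 0 ∧ 0 < (τ z).im ∧ ψ z = (τ z).im * Complex.normSq (y z) := by
  obtain ⟨a, m, n, c, c', hder⟩ := liouville_derivatives hD hψ heq
  have hψ0 : ∀ z ∈ D, (ψ z : ℂ) ≠ 0 := fun z hz => Complex.ofReal_ne_zero.2 (hpos z hz).ne'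
  obtain ⟨R, hR, hRD⟩ := Metric.isOpen_iff.1 hD z₀ hz₀
  have hq : DifferentiableOn ℂ (fun z => c z / ψ z) (Metric.ball z₀ R) := fun z hz => by
    obtain ⟨-, h1, -, -, -, h2, h3⟩ := hder z (hRD hz)
    refine ((h2.div h1 (hψ0 z (hRD hz))).hasDerivAt ?_).differentiableAt.differentiableWithinAt
    rw [mul_comm, h3, sub_self, zero_div]
  obtain ⟨s, hs⟩ : ∃ s : ℝ, (s : ℂ) * s = 1 / 2 := ⟨√(1 / 2), by
    rw [← Complex.ofReal_mul, Real.mul_self_sqrt (by norm_num)]; norm_num⟩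
  obtain ⟨r₁, hr₁, hr₁R, y, y', hy0, hy0', hode⟩ :=
    exists_hasDerivAt_second_order hR hq 1 ((a z₀ + s) / ψ z₀)
  -- a smaller disc, on which `y` has no zeros
  obtain ⟨r, hr, hrr₁, hyne⟩ : ∃ r > 0, r ≤ r₁ ∧ ∀ z ∈ Metric.ball z₀ r, y z ≠ 0 := by
    have hc : ContinuousAt y z₀ := (hode z₀ (Metric.mem_ball_self hr₁)).1.continuousAt
    have hne : ∀ᶠ z in nhds z₀, y z ≠ 0 := hc.eventually_ne (by rw [hy0]; exact one_ne_zero)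
    obtain ⟨ε, hε, h⟩ := Metric.eventually_nhds_iff_ball.1 hne
    exact ⟨min ε r₁, lt_min hε hr₁, min_le_right _ _, fun z hz =>
      h z (Metric.ball_subset_ball (min_le_left _ _) hz)⟩
  set B := Metric.ball z₀ r
  have hBo : IsOpen B := Metric.isOpen_ball
  have hBc : Convex ℝ B := convex_ball z₀ r
  have hB0 : z₀ ∈ B := Metric.mem_ball_self hr
  have hBD : B ⊆ D := (Metric.ball_subset_ball (hrr₁.trans hr₁R)).trans hRD
  have hyw : ∀ z ∈ B, HasDerivAt y (y' z) z ∧ HasDerivAt y' (c z / ψ z * y z) z := fun z hz =>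
    hode z (Metric.ball_subset_ball hrr₁ hz)
  -- the conjugate of `ψ_z y - ψ y'` is holomorphic and solves the same equation as `y`
  let b := fun z => conj (a z) * conj (y z) - ψ z * conj (y' z)
  let b' := fun z => m z * conj (y z) - a z * conj (y' z)
  have hb : ∀ z ∈ B, HasDerivAt b (b' z) z := fun z hz => by
    obtain ⟨-, h1, h2, hm, -, -, -⟩ := hder z (hBD hz)
    have hy := hyw z hz
    have h := (h2.conj.mul hy.1.hasWirt.conj).sub (h1.mul hy.2.hasWirt.conj)
    refine (h.congr_val ?_ rfl).hasDerivAt ?_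
    · simp [b', hm]
    · have := hψ0 z (hBD hz)
      simp only [map_mul, map_div₀, Complex.conj_ofReal]
      field_simp
      ring
  have hb' : ∀ z ∈ B, HasDerivAt b' (c z / ψ z * b z) z := fun z hz => by
    obtain ⟨-, h1, h2, hm, hmn, -, hn⟩ := hder z (hBD hz)
    have hy := hyw z hz
    have h0 := hψ0 z (hBD hz)
    have hn' := congrArg conj hn
    simp only [map_mul, Complex.conj_ofReal, Complex.conj_conj] at hn'
    have h := (hmn.mul hy.1.hasWirt.conj).sub (h2.mul hy.2.hasWirt.conj)
    refine (h.congr_val ?_ rfl).hasDerivAt ?_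
    · simp only [b, map_zero]
      field_simp
      linear_combination conj (y z) * hn
    · simp only [map_mul, map_div₀, Complex.conj_ofReal]
      field_simp
      linear_combination conj (y z) * hn'
  have hb0 : b z₀ = -s := by
    have h0 := hψ0 z₀ hz₀
    simp only [b, hy0, hy0', map_one, map_div₀, map_add, Complex.conj_ofReal]
    field_simp
    ring
  have hb0' : b' z₀ = -s * y' z₀ := by
    have h0 := hψ0 z₀ hz₀
    have h := (hder z₀ hz₀).1
    simp only [b', hy0, hy0', map_one, map_div₀, map_add, Complex.conj_ofReal]
    field_simp
    linear_combination h + hs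
  have hW : ∀ z ∈ B, b z * y' z - b' z * y z = 0 := fun z hz => by
    have h := eq_of_hasWirt_zero hBo hBc (f := fun z => b z * y' z - b' z * y z)
      (fun z hz => ((((hb z hz).mul (hyw z hz).2).sub
        ((hb' z hz).mul (hyw z hz).1)).hasWirt).congr_val (by ring) rfl) hz hB0
    rw [h, hb0, hb0', hy0]
    ring
  have hby : ∀ z ∈ B, b z = -s * y z := fun z hz => by
    have h := eq_of_hasWirt_zero hBo hBc (f := fun z => b z / y z)
      (fun z hz => (((hb z hz).div (hyw z hz).1 (hyne z hz)).hasWirt).congr_val (by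
        rw [div_eq_zero_iff]
        left
        linear_combination -hW z hz) rfl) hz hB0
    simp only [hb0, hy0, div_one] at h
    rwa [div_eq_iff (hyne z hz)] at h
  -- `v = ψ / |y|²` is the imaginary part of a holomorphic function
  have hyd : DifferentiableOn ℂ y B := fun z hz =>
    (hyw z hz).1.differentiableAt.differentiableWithinAt
  obtain ⟨F, hF, hFv⟩ := exists_re_eq hBo hBc (v := fun z => ψ z / Complex.normSq (y z))
    (g := fun z => -s / y z ^ 2)
    ((differentiableOn_const _).div (hyd.pow 2) fun z hz => pow_ne_zero 2 (hyne z hz))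
    (fun z hz => by
      obtain ⟨-, h1, -, -, -, -, -⟩ := hder z (hBD hz)
      have hy := (hyw z hz).1.hasWirt
      have hne := hyne z hz
      have hne' : conj (y z) ≠ 0 := (map_ne_zero _).2 hne
      have hB := hby z hz
      have hB' := congrArg conj hB
      simp only [b, map_sub, map_mul, map_neg, Complex.conj_ofReal, Complex.conj_conj] at hB hB'
      refine ((h1.div (hy.mul hy.conj) (mul_ne_zero hne hne')).congr
        (Filter.Eventually.of_forall fun w => ?_)).congr_val ?_ ?_
      · simp only [Complex.ofReal_div, Complex.mul_conj]
      · simp only [map_zero]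
        field_simp
        linear_combination conj (y z) * hB'
      · simp only [map_div₀, map_neg, map_pow, Complex.conj_ofReal]
        field_simp
        linear_combination y z * hB)
  refine ⟨r, hr, hBD, y, fun z => Complex.I * F z, hyd, fun z hz =>
    ((hF z hz).const_mul _).differentiableAt.differentiableWithinAt, fun z hz => ?_⟩
  have hn : 0 < Complex.normSq (y z) := Complex.normSq_pos.2 (hyne z hz)
  have him : (Complex.I * F z).im = ψ z / Complex.normSq (y z) := by
    rw [Complex.I_mul_im]; exact hFv z hz
  refine ⟨hyne z hz, ?_, ?_⟩
  · rw [him]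
    exact div_pos (hpos z (hBD hz)) hn
  · rw [him, div_mul_cancel₀ _ hn.ne']

/-! ### Metrics on plane domains in triangular form -/

theorem contDiffOn_pd {m : ℕ} {U : Set (Coord m)} (hU : IsOpen U) {f : Coord m → ℝ}
    (hf : ContDiffOn ℝ ∞ f U) (i : Fin m) : ContDiffOn ℝ ∞ (pd i f) U :=
  contDiffOn_fderiv_apply hU hf _

theorem hasPd_of_contDiffOn {m : ℕ} {U : Set (Coord m)} (hU : IsOpen U) {f : Coord m → ℝ}
    (hf : ContDiffOn ℝ ∞ f U) {x : Coord m} (hx : x ∈ U) (i : Fin m) : HasPd i f (pd i f x) x :=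
  ((hf.contDiffAt (hU.mem_nhds hx)).differentiableAt (by simp)).hasPd

theorem pd_pd_comm {m : ℕ} {U : Set (Coord m)} (hU : IsOpen U) {f : Coord m → ℝ}
    (hf : ContDiffOn ℝ ∞ f U) {x : Coord m} (hx : x ∈ U) (i j : Fin m) :
    pd i (pd j f) x = pd j (pd i f) x := by
  have hs := isSymmSndFDerivAt_of_contDiffOn hU hf hx
  have h := hasFDerivAt_fderiv_apply hU hf hx
  have h' : ∀ i j, pd i (pd j f) x = fderiv ℝ (fderiv ℝ f) x (Pi.single i 1) (Pi.single j 1) :=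
    fun i j => ((h (Pi.single j 1)).hasPd (i := i)).2
  rw [h', h', hs.eq]

theorem christoffel_congr {n : ℕ} {U : Set (Coord n)} (hU : IsOpen U) {g g' : MatField n}
    (h : ∀ x ∈ U, g x = g' x) {x : Coord n} (hx : x ∈ U) (k i j : Fin n) :
    christoffel g k i j x = christoffel g' k i j x := by
  have hpd : ∀ l a b, pd l (fun y => g y a b) x = pd l (fun y => g' y a b) x := fun l a b =>
    pd_congr hU (fun y hy => by rw [h y hy]) hx
  simp only [christoffel, hpd, h x hx]

theorem gaussCurvature_congr {U : Set (Coord 2)} (hU : IsOpen U) {g g' : MatField 2}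
    (h : ∀ x ∈ U, g x = g' x) {x : Coord 2} (hx : x ∈ U) :
    gaussCurvature g x = gaussCurvature g' x := by
  have hpd : ∀ m l a b, pd m (christoffel g l a b) x = pd m (christoffel g' l a b) x :=
    fun m l a b => pd_congr hU (fun y hy => christoffel_congr hU h hy l a b) hx
  simp only [gaussCurvature, riemann, hpd, h x hx, christoffel_congr hU h hx]

/-- The metric with orthonormal coframe `α dx₀ + β dx₁`, `γ dx₁`. -/
def triMetric (α β γ : Coord 2 → ℝ) : MatField 2 := fun x =>
  !![α x ^ 2, α x * β x; α x * β x, β x ^ 2 + γ x ^ 2]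

/-- The components of the connection form `ω` of the coframe `θ¹ = α dx₀ + β dx₁`, `θ² = γ dx₁`,
determined by `dθ¹ = ω ∧ θ²`, `dθ² = -ω ∧ θ¹`. -/
def connForm (α β γ : Coord 2 → ℝ) : Fin 2 → Coord 2 → ℝ :=
  ![fun x => (pd 0 β x - pd 1 α x) / γ x,
    fun x => (pd 0 γ x + (pd 0 β x - pd 1 α x) / γ x * β x) / α x]

/-- The Christoffel symbols of the connection with connection form `ω` in the frame dual to
`α dx₀ + β dx₁`, `γ dx₁`. -/
def triGamma (α β γ : ℝ) (α' β' γ' w : Fin 2 → ℝ) (k i j : Fin 2) : ℝ :=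
  ![![α' i / α - w i * β / γ, (β' i - γ * w i) / α - β * (β * w i + γ' i) / (α * γ)],
    ![α * w i / γ, (β * w i + γ' i) / γ]] k j

section Tri

variable {U : Set (Coord 2)} {α β γ : Coord 2 → ℝ}

theorem triMetric_inv {x : Coord 2} (hα : α x ≠ 0) (hγ : γ x ≠ 0) :
    (triMetric α β γ x)⁻¹ = !![(β x ^ 2 + γ x ^ 2) / (α x * γ x) ^ 2, -(β x / (α x * γ x ^ 2));
      -(β x / (α x * γ x ^ 2)), 1 / γ x ^ 2] := by
  apply Matrix.inv_eq_right_inv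
  ext i j
  fin_cases i <;> fin_cases j <;>
    simp [triMetric, Matrix.mul_apply, Fin.sum_univ_two] <;> field_simp <;> ring

theorem christoffel_triMetric {x : Coord 2} (hα : DifferentiableAt ℝ α x)
    (hβ : DifferentiableAt ℝ β x) (hγ : DifferentiableAt ℝ γ x) (hα0 : α x ≠ 0) (hγ0 : γ x ≠ 0)
    (k i j : Fin 2) :
    christoffel (triMetric α β γ) k i j x =
      triGamma (α x) (β x) (γ x) (pd · α x) (pd · β x) (pd · γ x) (connForm α β γ · x) k i j := by
  have h00 : ∀ l, pd l (fun y => triMetric α β γ y 0 0) x = 2 * α x * pd l α x := fun l => by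
    have h := (hα.hasPd (i := l)).mul hα.hasPd
    simp only [← pow_two] at h
    exact h.2.trans (by ring)
  have h01 : ∀ l, pd l (fun y => triMetric α β γ y 0 1) x = α x * pd l β x + β x * pd l α x :=
    fun l => ((hα.hasPd (i := l)).mul hβ.hasPd).2
  have h10 : ∀ l, pd l (fun y => triMetric α β γ y 1 0) x = α x * pd l β x + β x * pd l α x := h01
  have h11 : ∀ l, pd l (fun y => triMetric α β γ y 1 1) x =
      2 * β x * pd l β x + 2 * γ x * pd l γ x := fun l => by
    have h := ((hβ.hasPd (i := l)).mul hβ.hasPd).add (hγ.hasPd.mul hγ.hasPd)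
    simp only [← pow_two] at h
    exact h.2.trans (by ring)
  rw [christoffel, triMetric_inv hα0 hγ0]
  fin_cases k <;> fin_cases i <;> fin_cases j <;>
    simp [Fin.sum_univ_two, h00, h01, h10, h11, triGamma, connForm] <;> field_simp <;> ring

theorem contDiffOn_connForm (hU : IsOpen U) (hα : ContDiffOn ℝ ∞ α U) (hβ : ContDiffOn ℝ ∞ β U)
    (hγ : ContDiffOn ℝ ∞ γ U) (hα0 : ∀ x ∈ U, α x ≠ 0) (hγ0 : ∀ x ∈ U, γ x ≠ 0) (i : Fin 2) :
    ContDiffOn ℝ ∞ (connForm α β γ i) U := by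
  have hp : ContDiffOn ℝ ∞ (fun x => (pd 0 β x - pd 1 α x) / γ x) U :=
    ((contDiffOn_pd hU hβ 0).sub (contDiffOn_pd hU hα 1)).div hγ hγ0
  fin_cases i
  · exact hp
  · exact ((contDiffOn_pd hU hγ 0).add (hp.mul hβ)).div hα hα0

/-- The Gauss equation `dω = -K dA` in an orthonormal frame. -/
theorem gaussCurvature_triMetric (hU : IsOpen U) (hα : ContDiffOn ℝ ∞ α U)
    (hβ : ContDiffOn ℝ ∞ β U) (hγ : ContDiffOn ℝ ∞ γ U) (hα0 : ∀ x ∈ U, α x ≠ 0)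
    (hγ0 : ∀ x ∈ U, γ x ≠ 0) {x : Coord 2} (hx : x ∈ U) :
    gaussCurvature (triMetric α β γ) x =
      -(pd 0 (connForm α β γ 1) x - pd 1 (connForm α β γ 0) x) / (α x * γ x) := by
  have hd : ∀ {f : Coord 2 → ℝ}, ContDiffOn ℝ ∞ f U → ∀ y ∈ U, DifferentiableAt ℝ f y :=
    fun hf y hy => (hf.contDiffAt (hU.mem_nhds hy)).differentiableAt (by simp)
  have hΓ : ∀ y ∈ U, ∀ k i j, christoffel (triMetric α β γ) k i j y = _ := fun y hy =>
    christoffel_triMetric (hd hα y hy) (hd hβ y hy) (hd hγ y hy) (hα0 y hy) (hγ0 y hy)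
  have hω := contDiffOn_connForm hU hα hβ hγ hα0 hγ0
  have ha := hα0 x hx
  have hc := hγ0 x hx
  have hac : α x * γ x ≠ 0 := mul_ne_zero ha hc
  have Hα := fun l => hasPd_of_contDiffOn hU hα hx l
  have Hβ := fun l => hasPd_of_contDiffOn hU hβ hx l
  have Hγ := fun l => hasPd_of_contDiffOn hU hγ hx l
  have Hω := fun i l => hasPd_of_contDiffOn hU (hω i) hx l
  have Hβ' := fun i l => hasPd_of_contDiffOn hU (contDiffOn_pd hU hβ i) hx l
  have Hγ' := fun i l => hasPd_of_contDiffOn hU (contDiffOn_pd hU hγ i) hx l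
  have hpd0 : ∀ l i, pd l (christoffel (triMetric α β γ) 0 i 1) x = _ := fun l i =>
    (pd_congr hU (fun y hy => hΓ y hy 0 i 1) hx).trans
      ((((Hβ' i l).sub ((Hγ l).mul (Hω i l))).div (Hα l) ha).sub
        (((Hβ l).mul (((Hβ l).mul (Hω i l)).add (Hγ' i l))).div ((Hα l).mul (Hγ l)) hac)).2
  have hpd1 : ∀ l i, pd l (christoffel (triMetric α β γ) 1 i 1) x = _ := fun l i =>
    (pd_congr hU (fun y hy => hΓ y hy 1 i 1) hx).trans
      ((((Hβ l).mul (Hω i l)).add (Hγ' i l)).div (Hγ l) hc).2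
  have cβ := pd_pd_comm hU hβ hx 0 1
  have cγ := pd_pd_comm hU hγ hx 0 1
  have hdet : (triMetric α β γ x).det = (α x * γ x) ^ 2 := by
    simp [triMetric, Matrix.det_fin_two]
    ring
  simp only [gaussCurvature, riemann, Fin.sum_univ_two, hpd0, hpd1, hΓ x hx, hdet, triGamma]
  simp [triMetric, cβ, cγ]
  field_simp
  ring

end Tri

/-! ### Conformal change and flat coordinates -/

section Plane

variable {U : Set (Coord 2)} {α β γ : Coord 2 → ℝ}

theorem clm_apply_eq_sum (L : Coord 2 →L[ℝ] ℝ) (v : Coord 2) :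
    L v = v 0 * L (Pi.single 0 1) + v 1 * L (Pi.single 1 1) := by
  have h : v = v 0 • Pi.single 0 1 + v 1 • Pi.single 1 1 := by
    ext i
    fin_cases i <;> simp
  conv_lhs => rw [h]
  simp

/-- The Poincaré lemma for `u dx₀ + v dx₁`. -/
theorem exists_potential (hU : IsOpen U) (hc : Convex ℝ U) {u v : Coord 2 → ℝ}
    (hu : ContDiffOn ℝ ∞ u U) (hv : ContDiffOn ℝ ∞ v U)
    (hcl : ∀ x ∈ U, pd 0 v x = pd 1 u x) :
    ∃ f : Coord 2 → ℝ, ContDiffOn ℝ ∞ f U ∧ ∀ x ∈ U, pd 0 f x = u x ∧ pd 1 f x = v x := by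
  let e : Fin 2 → Coord 2 →L[ℝ] ℝ := fun i => ContinuousLinearMap.proj i
  let η : Coord 2 → Coord 2 →L[ℝ] ℝ := fun x => u x • e 0 + v x • e 1
  have hη : ContDiffOn ℝ ∞ η U :=
    (hu.smul contDiffOn_const).add (hv.smul contDiffOn_const)
  have hηd : DifferentiableOn ℝ η U := hη.differentiableOn (by simp)
  obtain ⟨f, hf⟩ := hc.exists_forall_hasFDerivAt_of_fderiv_symmetric hU hηd fun a ha x y => by
    have h1 := ((hu.contDiffAt (hU.mem_nhds ha)).differentiableAt (by simp)).hasFDerivAt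
    have h2 := ((hv.contDiffAt (hU.mem_nhds ha)).differentiableAt (by simp)).hasFDerivAt
    have h : HasFDerivAt η _ a := (h1.smul_const (e 0)).add (h2.smul_const (e 1))
    have h' := hcl a ha
    simp only [pd] at h'
    rw [h.fderiv]
    simp [e, clm_apply_eq_sum (fderiv ℝ u a) x, clm_apply_eq_sum (fderiv ℝ u a) y,
      clm_apply_eq_sum (fderiv ℝ v a) x, clm_apply_eq_sum (fderiv ℝ v a) y, h']
    ring
  refine ⟨f, ?_, fun x hx => ⟨?_, ?_⟩⟩
  · refine (contDiffOn_infty_iff_fderiv_of_isOpen hU).2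
      ⟨fun x hx => (hf x hx).differentiableAt.differentiableWithinAt,
        hη.congr fun x hx => (hf x hx).fderiv⟩
  · rw [pd, (hf x hx).fderiv]
    simp [η, e]
  · rw [pd, (hf x hx).fderiv]
    simp [η, e]

/-- Every metric on a plane domain has a triangular form, by Gram-Schmidt. -/
theorem exists_triMetric {g : MatField 2} (hg : IsMetricOn g U) :
    ∃ α β γ : Coord 2 → ℝ, ContDiffOn ℝ ∞ α U ∧ ContDiffOn ℝ ∞ β U ∧ ContDiffOn ℝ ∞ γ U ∧
      (∀ x ∈ U, 0 < α x) ∧ (∀ x ∈ U, 0 < γ x) ∧ ∀ x ∈ U, g x = triMetric α β γ x := by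
  have h0 : ∀ x ∈ U, 0 < g x 0 0 := fun x hx => (hg.posDef x hx).diag_pos
  have hsym : ∀ x ∈ U, g x 1 0 = g x 0 1 := fun x hx => by
    simpa using (hg.posDef x hx).isHermitian.apply 0 1
  have hdet : ∀ x ∈ U, 0 < g x 1 1 - g x 0 1 ^ 2 / g x 0 0 := fun x hx => by
    have h := (hg.posDef x hx).det_pos
    rw [Matrix.det_fin_two, hsym x hx] at h
    have h1 := h0 x hx
    rw [sub_pos, div_lt_iff₀ h1]
    linarith
  have hα : ContDiffOn ℝ ∞ (fun x => √(g x 0 0)) U := (hg.smooth 0 0).sqrt fun x hx => (h0 x hx).ne'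
  have hα0 : ∀ x ∈ U, 0 < √(g x 0 0) := fun x hx => Real.sqrt_pos.2 (h0 x hx)
  refine ⟨fun x => √(g x 0 0), fun x => g x 0 1 / √(g x 0 0),
    fun x => √(g x 1 1 - g x 0 1 ^ 2 / g x 0 0), hα, (hg.smooth 0 1).div hα fun x hx => (hα0 x hx).ne',
    ((hg.smooth 1 1).sub (((hg.smooth 0 1).pow 2).div (hg.smooth 0 0) fun x hx =>
      (h0 x hx).ne')).sqrt fun x hx => (hdet x hx).ne', hα0,
    fun x hx => Real.sqrt_pos.2 (hdet x hx), fun x hx => ?_⟩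
  have e0 := Real.sq_sqrt (h0 x hx).le
  have e1 := Real.sq_sqrt (hdet x hx).le
  have hne := (hα0 x hx).ne'
  ext i j
  fin_cases i <;> fin_cases j
  · simp [triMetric, e0]
  · simp [triMetric]; field_simp
  · simp [triMetric, hsym x hx]; field_simp
  · simp [triMetric, e1, div_pow, e0]

theorem sqrt_det_triMetric {x : Coord 2} (hα : 0 < α x) (hγ : 0 < γ x) :
    √(triMetric α β γ x).det = α x * γ x := by
  have : (triMetric α β γ x).det = (α x * γ x) ^ 2 := by
    simp [triMetric, Matrix.det_fin_two]
    ring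
  rw [this, Real.sqrt_sq (by positivity)]

/-- The components of the one-form `*dn`, in the order and with the signs in which they are added
to the connection form when the metric is multiplied by `exp (2 n)`. -/
def starGrad (α β γ n : Coord 2 → ℝ) : Fin 2 → Coord 2 → ℝ :=
  ![fun x => (pd 0 n x * β x - pd 1 n x * α x) / γ x,
    fun x => ((β x ^ 2 + γ x ^ 2) * pd 0 n x - α x * β x * pd 1 n x) / (α x * γ x)]

theorem laplacian_triMetric (hU : IsOpen U) (hα0 : ∀ x ∈ U, 0 < α x) (hγ0 : ∀ x ∈ U, 0 < γ x)
    (n : Coord 2 → ℝ) {x : Coord 2} (hx : x ∈ U) :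
    laplacian (triMetric α β γ) n x =
      (pd 0 (starGrad α β γ n 1) x + pd 1 (fun y => -starGrad α β γ n 0 y) x) / (α x * γ x) := by
  have h0 : ∀ y ∈ U, √(triMetric α β γ y).det * ∑ j, (triMetric α β γ y)⁻¹ 0 j * pd j n y =
      starGrad α β γ n 1 y := fun y hy => by
    have h1 := (hα0 y hy).ne'
    have h2 := (hγ0 y hy).ne'
    rw [sqrt_det_triMetric (hα0 y hy) (hγ0 y hy), triMetric_inv h1 h2]
    simp [starGrad, Fin.sum_univ_two]
    field_simp
    ring
  have h1 : ∀ y ∈ U, √(triMetric α β γ y).det * ∑ j, (triMetric α β γ y)⁻¹ 1 j * pd j n y =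
      -starGrad α β γ n 0 y := fun y hy => by
    have h1 := (hα0 y hy).ne'
    have h2 := (hγ0 y hy).ne'
    rw [sqrt_det_triMetric (hα0 y hy) (hγ0 y hy), triMetric_inv h1 h2]
    simp [starGrad, Fin.sum_univ_two]
    field_simp
    ring
  rw [laplacian, Fin.sum_univ_two, pd_congr hU h0 hx, pd_congr hU h1 hx,
    sqrt_det_triMetric (hα0 x hx) (hγ0 x hx), one_div, inv_mul_eq_div]

/-- The Gauss curvature of the conformal metric `exp (2 n) g`. -/
theorem gaussCurvature_conformal (hU : IsOpen U) (hα : ContDiffOn ℝ ∞ α U)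
    (hβ : ContDiffOn ℝ ∞ β U) (hγ : ContDiffOn ℝ ∞ γ U) (hα0 : ∀ x ∈ U, 0 < α x)
    (hγ0 : ∀ x ∈ U, 0 < γ x) {n : Coord 2 → ℝ} (hn : ContDiffOn ℝ ∞ n U) {x : Coord 2}
    (hx : x ∈ U) :
    gaussCurvature (fun y => Real.exp (2 * n y) • triMetric α β γ y) x * Real.exp (2 * n x) =
      gaussCurvature (triMetric α β γ) x - laplacian (triMetric α β γ) n x := by
  have hm : ContDiffOn ℝ ∞ (fun y => Real.exp (n y)) U := hn.exp
  have hα0' := fun x hx => (hα0 x hx).ne'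
  have hγ0' := fun x hx => (hγ0 x hx).ne'
  have hE : ∀ y ∈ U, Real.exp (2 * n y) • triMetric α β γ y =
      triMetric (fun y => Real.exp (n y) * α y) (fun y => Real.exp (n y) * β y)
        (fun y => Real.exp (n y) * γ y) y := fun y _ => by
    rw [two_mul, Real.exp_add]
    ext i j
    fin_cases i <;> fin_cases j <;> simp [triMetric] <;> ring
  have hpd : ∀ {f : Coord 2 → ℝ}, ContDiffOn ℝ ∞ f U → ∀ y ∈ U, ∀ i,
      pd i (fun y => Real.exp (n y) * f y) y = Real.exp (n y) * (pd i f y + f y * pd i n y) :=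
    fun {f} hf y hy i => by
      have h1 := (hasPd_of_contDiffOn hU hn hy i)
      have h2 : HasPd i (fun y => Real.exp (n y)) (Real.exp (n y) * pd i n y) y := by
        refine (h1.1.hasFDerivAt.exp.hasPd (i := i)).congr_val ?_
        simp [pd]
      exact (h2.mul (hasPd_of_contDiffOn hU hf hy i)).2.trans (by ring)
  have hω0 : ∀ y ∈ U, connForm (fun y => Real.exp (n y) * α y) (fun y => Real.exp (n y) * β y)
      (fun y => Real.exp (n y) * γ y) 0 y = connForm α β γ 0 y - -starGrad α β γ n 0 y :=
    fun y hy => by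
      have h1 := hα0' y hy
      have h2 := hγ0' y hy
      simp [connForm, starGrad, hpd hα y hy, hpd hβ y hy]
      field_simp
      ring
  have hω1 : ∀ y ∈ U, connForm (fun y => Real.exp (n y) * α y) (fun y => Real.exp (n y) * β y)
      (fun y => Real.exp (n y) * γ y) 1 y = connForm α β γ 1 y + starGrad α β γ n 1 y :=
    fun y hy => by
      have h1 := hα0' y hy
      have h2 := hγ0' y hy
      simp [connForm, starGrad, hpd hα y hy, hpd hβ y hy, hpd hγ y hy]
      field_simp
      ring
  have hω := contDiffOn_connForm hU hα hβ hγ hα0' hγ0'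
  have hs0 : ContDiffOn ℝ ∞ (starGrad α β γ n 0) U :=
    (((contDiffOn_pd hU hn 0).mul hβ).sub ((contDiffOn_pd hU hn 1).mul hα)).div hγ hγ0'
  have hs1 : ContDiffOn ℝ ∞ (starGrad α β γ n 1) U :=
    ((((hβ.pow 2).add (hγ.pow 2)).mul (contDiffOn_pd hU hn 0)).sub
      ((hα.mul hβ).mul (contDiffOn_pd hU hn 1))).div (hα.mul hγ)
      fun y hy => mul_ne_zero (hα0' y hy) (hγ0' y hy)
  have hd0 := ((hasPd_of_contDiffOn hU (hω 0) hx 1).sub (hasPd_of_contDiffOn hU hs0 hx 1).neg).2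
  have hd1 := ((hasPd_of_contDiffOn hU (hω 1) hx 0).add (hasPd_of_contDiffOn hU hs1 hx 0)).2
  rw [gaussCurvature_congr hU hE hx, gaussCurvature_triMetric hU (hm.mul hα) (hm.mul hβ)
    (hm.mul hγ) (fun y hy => mul_ne_zero (Real.exp_ne_zero _) (hα0' y hy))
    (fun y hy => mul_ne_zero (Real.exp_ne_zero _) (hγ0' y hy)) hx,
    gaussCurvature_triMetric hU hα hβ hγ hα0' hγ0' hx, laplacian_triMetric hU hα0 hγ0 n hx,
    pd_congr hU hω0 hx, pd_congr hU hω1 hx, hd0, hd1, two_mul, Real.exp_add,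
    (hasPd_of_contDiffOn hU hs0 hx 1).neg.2]
  have h1 := hα0' x hx
  have h2 := hγ0' x hx
  field_simp
  ring

/-- A flat metric on a convex plane domain has flat coordinates: the connection form is exact, and
rotating the frame by its potential makes the coframe closed. -/
theorem exists_flat_coordinates (hU : IsOpen U) (hc : Convex ℝ U) (hα : ContDiffOn ℝ ∞ α U)
    (hβ : ContDiffOn ℝ ∞ β U) (hγ : ContDiffOn ℝ ∞ γ U) (hα0 : ∀ x ∈ U, 0 < α x)
    (hγ0 : ∀ x ∈ U, 0 < γ x) (hflat : ∀ x ∈ U, gaussCurvature (triMetric α β γ) x = 0) :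
    ∃ P Q : Coord 2 → ℝ, ContDiffOn ℝ ∞ P U ∧ ContDiffOn ℝ ∞ Q U ∧ ∀ x ∈ U,
      (∀ a b, pd a P x * pd b P x + pd a Q x * pd b Q x = triMetric α β γ x a b) ∧
      0 < pd 0 P x * pd 1 Q x - pd 1 P x * pd 0 Q x := by
  have hα0' := fun x hx => (hα0 x hx).ne'
  have hγ0' := fun x hx => (hγ0 x hx).ne'
  have hω := contDiffOn_connForm hU hα hβ hγ hα0' hγ0'
  obtain ⟨t, ht, htω⟩ := exists_potential hU hc (hω 0) (hω 1) fun x hx => by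
    have h := hflat x hx
    rw [gaussCurvature_triMetric hU hα hβ hγ hα0' hγ0' hx, div_eq_zero_iff] at h
    have := h.resolve_right (mul_ne_zero (hα0' x hx) (hγ0' x hx))
    linarith
  have hcos : ContDiffOn ℝ ∞ (fun x => Real.cos (t x)) U := ht.cos
  have hsin : ContDiffOn ℝ ∞ (fun x => Real.sin (t x)) U := ht.sin
  have hpc : ∀ x ∈ U, ∀ i, HasPd i (fun x => Real.cos (t x)) (-Real.sin (t x) * pd i t x) x :=
    fun x hx i => ((hasPd_of_contDiffOn hU ht hx i).1.hasFDerivAt.cos.hasPd (i := i)).congr_val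
      (by simp [pd])
  have hps : ∀ x ∈ U, ∀ i, HasPd i (fun x => Real.sin (t x)) (Real.cos (t x) * pd i t x) x :=
    fun x hx i => ((hasPd_of_contDiffOn hU ht hx i).1.hasFDerivAt.sin.hasPd (i := i)).congr_val
      (by simp [pd])
  -- the structure equations
  have hω0 : ∀ x ∈ U, pd 0 t x * γ x = pd 0 β x - pd 1 α x := fun x hx => by
    rw [(htω x hx).1]
    exact div_mul_cancel₀ _ (hγ0' x hx)
  have hω1 : ∀ x ∈ U, pd 1 t x * α x = pd 0 γ x + pd 0 t x * β x := fun x hx => by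
    rw [(htω x hx).1, (htω x hx).2]
    exact div_mul_cancel₀ _ (hα0' x hx)
  obtain ⟨P, hP, hPd⟩ := exists_potential hU hc (hcos.mul hα) ((hcos.mul hβ).sub (hsin.mul hγ))
    fun x hx => by
      have Hα := hasPd_of_contDiffOn hU hα hx
      have Hβ := hasPd_of_contDiffOn hU hβ hx
      have Hγ := hasPd_of_contDiffOn hU hγ hx
      refine (((hpc x hx 0).mul (Hβ 0)).sub ((hps x hx 0).mul (Hγ 0))).2.trans
        (Eq.trans ?_ ((hpc x hx 1).mul (Hα 1)).2.symm)
      linear_combination -Real.cos (t x) * hω0 x hx + Real.sin (t x) * hω1 x hx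
  obtain ⟨Q, hQ, hQd⟩ := exists_potential hU hc (hsin.mul hα) ((hsin.mul hβ).add (hcos.mul hγ))
    fun x hx => by
      have Hα := hasPd_of_contDiffOn hU hα hx
      have Hβ := hasPd_of_contDiffOn hU hβ hx
      have Hγ := hasPd_of_contDiffOn hU hγ hx
      refine (((hps x hx 0).mul (Hβ 0)).add ((hpc x hx 0).mul (Hγ 0))).2.trans
        (Eq.trans ?_ ((hps x hx 1).mul (Hα 1)).2.symm)
      linear_combination -Real.sin (t x) * hω0 x hx - Real.cos (t x) * hω1 x hx
  refine ⟨P, Q, hP, hQ, fun x hx => ⟨fun a b => ?_, ?_⟩⟩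
  · have h := Real.sin_sq_add_cos_sq (t x)
    fin_cases a <;> fin_cases b <;>
      simp only [Fin.zero_eta, Fin.mk_one, (hPd x hx).1, (hPd x hx).2, (hQd x hx).1, (hQd x hx).2,
        triMetric, Matrix.of_apply, Matrix.cons_val', Matrix.cons_val_zero, Matrix.cons_val_one,
        Matrix.cons_val_fin_one]
    · linear_combination α x ^ 2 * h
    · linear_combination α x * β x * h
    · linear_combination α x * β x * h
    · linear_combination (β x ^ 2 + γ x ^ 2) * h
  · have h := Real.sin_sq_add_cos_sq (t x)
    have : pd 0 P x * pd 1 Q x - pd 1 P x * pd 0 Q x = α x * γ x := by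
      rw [(hPd x hx).1, (hPd x hx).2, (hQd x hx).1, (hQd x hx).2]
      linear_combination α x * γ x * h
    rw [this]
    exact mul_pos (hα0 x hx) (hγ0 x hx)

end Plane

/-! ### Leaf-like metrics in flat coordinates -/

/-- The inverse function theorem for smooth maps with invertible derivative everywhere. -/
theorem exists_openPartialHomeomorph {𝕜 E F : Type*} [RCLike 𝕜] [NormedAddCommGroup E]
    [NormedSpace 𝕜 E] [NormedAddCommGroup F] [NormedSpace 𝕜 F] [CompleteSpace E] {f : E → F}
    {U : Set E} (hU : IsOpen U) (hf : ContDiffOn 𝕜 ∞ f U)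
    (hinv : ∀ x ∈ U, ∃ L : E ≃L[𝕜] F, HasFDerivAt f (L : E →L[𝕜] F) x) {p : E} (hp : p ∈ U) :
    ∃ e : OpenPartialHomeomorph E F, p ∈ e.source ∧ e.source ⊆ U ∧ ⇑e = f ∧
      ContDiffOn 𝕜 ∞ e.symm e.target := by
  obtain ⟨L, hL⟩ := hinv p hp
  have hfp : ContDiffAt 𝕜 ∞ f p := hf.contDiffAt (hU.mem_nhds hp)
  let e := (hfp.toOpenPartialHomeomorph f hL (by simp)).restrOpen U hU
  have he : ⇑e = f := rfl
  refine ⟨e, ⟨hfp.mem_toOpenPartialHomeomorph_source hL (by simp), hp⟩, fun x hx => hx.2, he, ?_⟩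
  intro y hy
  have hyU : e.symm y ∈ U := (e.map_target hy).2
  obtain ⟨L', hL'⟩ := hinv _ hyU
  exact (e.contDiffAt_symm hy (by rwa [he])
    (by rw [he]; exact hf.contDiffAt (hU.mem_nhds hyU))).contDiffWithinAt

/-- `P + i Q`. -/
def complexCoord (P Q : Coord 2 → ℝ) (x : Coord 2) : ℂ := P x + Q x * Complex.I

section FlatCoordinates

variable {U : Set (Coord 2)} {P Q : Coord 2 → ℝ}

theorem contDiffOn_complexCoord (hP : ContDiffOn ℝ ∞ P U) (hQ : ContDiffOn ℝ ∞ Q U) :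
    ContDiffOn ℝ ∞ (complexCoord P Q) U :=
  (Complex.ofRealCLM.contDiff.comp_contDiffOn hP).add
    ((Complex.ofRealCLM.contDiff.comp_contDiffOn hQ).mul contDiffOn_const)

theorem hasFDerivAt_complexCoord {x : Coord 2} (hP : DifferentiableAt ℝ P x)
    (hQ : DifferentiableAt ℝ Q x) :
    HasFDerivAt (complexCoord P Q) (Complex.ofRealCLM.comp (fderiv ℝ P x)
      + Complex.I • Complex.ofRealCLM.comp (fderiv ℝ Q x)) x := by
  have h1 : HasFDerivAt (fun x => (P x : ℂ)) (Complex.ofRealCLM.comp (fderiv ℝ P x)) x :=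
    Complex.ofRealCLM.hasFDerivAt.comp x hP.hasFDerivAt
  have h2 : HasFDerivAt (fun x => (Q x : ℂ)) (Complex.ofRealCLM.comp (fderiv ℝ Q x)) x :=
    Complex.ofRealCLM.hasFDerivAt.comp x hQ.hasFDerivAt
  exact h1.add (h2.mul_const Complex.I)

theorem complexCoord_deriv_equiv {x : Coord 2} (hP : DifferentiableAt ℝ P x)
    (hQ : DifferentiableAt ℝ Q x) (hdet : pd 0 P x * pd 1 Q x - pd 1 P x * pd 0 Q x ≠ 0) :
    ∃ L : Coord 2 ≃L[ℝ] ℂ, HasFDerivAt (complexCoord P Q) (L : Coord 2 →L[ℝ] ℂ) x := by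
  have h := hasFDerivAt_complexCoord hP hQ
  set A := Complex.ofRealCLM.comp (fderiv ℝ P x) + Complex.I • Complex.ofRealCLM.comp (fderiv ℝ Q x)
  have hA : ∀ v, A v = ((v 0 * pd 0 P x + v 1 * pd 1 P x : ℝ) : ℂ)
      + ((v 0 * pd 0 Q x + v 1 * pd 1 Q x : ℝ) : ℂ) * Complex.I := fun v => by
    simp only [A, pd, ← clm_apply_eq_sum]
    simp [mul_comm]
  have hinj : Function.Injective A := by
    rw [injective_iff_map_eq_zero]
    intro v hv
    rw [hA] at hv
    have h1 := congrArg Complex.re hv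
    have h2 := congrArg Complex.im hv
    simp only [Complex.add_re, Complex.add_im, Complex.ofReal_re, Complex.ofReal_im,
      Complex.re_ofReal_mul, Complex.im_ofReal_mul, Complex.I_re, Complex.I_im, mul_zero, mul_one,
      add_zero, zero_add, Complex.zero_re, Complex.zero_im] at h1 h2
    have e0 : v 0 * (pd 0 P x * pd 1 Q x - pd 1 P x * pd 0 Q x) = 0 := by
      linear_combination pd 1 Q x * h1 - pd 1 P x * h2
    have e1 : v 1 * (pd 0 P x * pd 1 Q x - pd 1 P x * pd 0 Q x) = 0 := by
      linear_combination pd 0 P x * h2 - pd 0 Q x * h1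
    ext i
    fin_cases i
    · exact (mul_eq_zero.1 e0).resolve_right hdet
    · exact (mul_eq_zero.1 e1).resolve_right hdet
  let L := (LinearEquiv.ofInjectiveOfFinrankEq A.toLinearMap hinj
    (by simp [Complex.finrank_real_complex])).toContinuousLinearEquiv
  refine ⟨L, h.congr_fderiv ?_⟩
  ext v
  rfl

theorem hasPd_comp_complexCoord {F : ℂ → ℝ} {x : Coord 2} (hP : DifferentiableAt ℝ P x)
    (hQ : DifferentiableAt ℝ Q x) (hF : DifferentiableAt ℝ F (complexCoord P Q x)) (i : Fin 2) :
    HasPd i (fun y => F (complexCoord P Q y)) (fderiv ℝ F (complexCoord P Q x) 1 * pd i P x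
      + fderiv ℝ F (complexCoord P Q x) Complex.I * pd i Q x) x := by
  refine ((hF.hasFDerivAt.comp x (hasFDerivAt_complexCoord hP hQ)).hasPd (i := i)).congr_val ?_
  have h1 : ∀ r s : ℝ, (r : ℂ) + Complex.I * s = r • (1 : ℂ) + s • Complex.I := fun r s => by
    simp [mul_comm]
  simp only [ContinuousLinearMap.comp_apply, add_apply,
    smul_apply, Complex.ofRealCLM_apply, smul_eq_mul, h1, map_add, map_smul]
  simp only [pd]
  ring

theorem dzbar_dz_ofReal {W : Set ℂ} (hW : IsOpen W) {F : ℂ → ℝ} (hF : ContDiffOn ℝ ∞ F W) {z : ℂ}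
    (hz : z ∈ W) : dzbar (dz fun w => (F w : ℂ)) z =
      ((fderiv ℝ (fun w => fderiv ℝ F w 1) z 1
        + fderiv ℝ (fun w => fderiv ℝ F w Complex.I) z Complex.I : ℝ) : ℂ) / 4 := by
  have hs := isSymmSndFDerivAt_of_contDiffOn hW hF hz
  have h := hasFDerivAt_fderiv_apply hW hF hz
  have hc : ∀ u, HasFDerivAt (fun z => (fderiv ℝ F z u : ℂ)) _ z := fun u =>
    Complex.ofRealCLM.hasFDerivAt.comp z (h u)
  have hdz : ∀ w ∈ W, dz (fun w => (F w : ℂ)) w =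
      ((fderiv ℝ F w 1 : ℂ) - Complex.I * (fderiv ℝ F w Complex.I : ℂ)) * 2⁻¹ := fun w hw => by
    have h : HasFDerivAt (fun w => (F w : ℂ)) (Complex.ofRealCLM.comp (fderiv ℝ F w)) w :=
      Complex.ofRealCLM.hasFDerivAt.comp w
        ((hF.contDiffAt (hW.mem_nhds hw)).differentiableAt (by simp)).hasFDerivAt
    simp [dz, h.fderiv, div_eq_mul_inv]
  have h1 : HasFDerivAt (dz fun w => (F w : ℂ)) _ z :=
    (((hc 1).sub ((hc Complex.I).const_mul Complex.I)).mul_const (2⁻¹ : ℂ)).congr_of_eventuallyEq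
      (Filter.eventually_of_mem (hW.mem_nhds hz) hdz)
  have hs' := hs.eq Complex.I 1
  rw [dzbar, h1.fderiv, (h 1).fderiv, (h Complex.I).fderiv]
  simp [hs']
  ring_nf
  simp
  ring

/-- In flat coordinates `P`, `Q` the Laplace-Beltrami operator is the Euclidean one, `4 ∂∂̄`. -/
theorem laplacian_eq_dzbar_dz (hU : IsOpen U) (hP : ContDiffOn ℝ ∞ P U) (hQ : ContDiffOn ℝ ∞ Q U)
    {g : MatField 2}
    (hg : ∀ x ∈ U, ∀ a b, pd a P x * pd b P x + pd a Q x * pd b Q x = g x a b)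
    (hdet : ∀ x ∈ U, 0 < pd 0 P x * pd 1 Q x - pd 1 P x * pd 0 Q x) {W : Set ℂ} (hW : IsOpen W)
    {F : ℂ → ℝ} (hF : ContDiffOn ℝ ∞ F W) {f : Coord 2 → ℝ}
    (hUW : Set.MapsTo (complexCoord P Q) U W) (hf : ∀ x ∈ U, f x = F (complexCoord P Q x))
    {x : Coord 2} (hx : x ∈ U) :
    (laplacian g f x : ℂ) = 4 * dzbar (dz fun w => (F w : ℂ)) (complexCoord P Q x) := by
  have hPd := fun y hy => hasPd_of_contDiffOn hU hP (x := y) hy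
  have hQd := fun y hy => hasPd_of_contDiffOn hU hQ (x := y) hy
  have hcomp : ∀ {G : ℂ → ℝ}, ContDiffOn ℝ ∞ G W → ∀ y ∈ U, ∀ i, HasPd i
      (fun y => G (complexCoord P Q y)) (fderiv ℝ G (complexCoord P Q y) 1 * pd i P y
        + fderiv ℝ G (complexCoord P Q y) Complex.I * pd i Q y) y := fun hG y hy i =>
    hasPd_comp_complexCoord (hPd y hy 0).1 (hQd y hy 0).1
      ((hG.contDiffAt (hW.mem_nhds (hUW hy))).differentiableAt (by simp)) i
  have hfpd : ∀ y ∈ U, ∀ i, pd i f y = fderiv ℝ F (complexCoord P Q y) 1 * pd i P y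
      + fderiv ℝ F (complexCoord P Q y) Complex.I * pd i Q y := fun y hy i =>
    (pd_congr hU hf hy).trans (hcomp hF y hy i).2
  have hdetg : ∀ y ∈ U, √(g y).det = pd 0 P y * pd 1 Q y - pd 1 P y * pd 0 Q y := fun y hy => by
    rw [← Real.sqrt_sq (hdet y hy).le, Matrix.det_fin_two]
    simp only [← hg y hy]
    congr 1
    ring
  have hinv : ∀ y ∈ U, (g y)⁻¹ = (1 / (pd 0 P y * pd 1 Q y - pd 1 P y * pd 0 Q y) ^ 2) •
      !![g y 1 1, -g y 0 1; -g y 1 0, g y 0 0] := fun y hy => by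
    have h0 := (hdet y hy).ne'
    have hadj : g y * !![g y 1 1, -g y 0 1; -g y 1 0, g y 0 0] =
        (pd 0 P y * pd 1 Q y - pd 1 P y * pd 0 Q y) ^ 2 • (1 : Matrix (Fin 2) (Fin 2) ℝ) := by
      ext i j
      fin_cases i <;> fin_cases j <;>
        simp [Matrix.mul_apply, Fin.sum_univ_two, ← hg y hy] <;> ring
    apply Matrix.inv_eq_right_inv
    rw [Matrix.mul_smul, hadj, smul_smul, one_div_mul_cancel (pow_ne_zero 2 h0), one_smul]
  have hX0 : ∀ y ∈ U, √(g y).det * ∑ j, (g y)⁻¹ 0 j * pd j f y =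
      fderiv ℝ F (complexCoord P Q y) 1 * pd 1 Q y
        - fderiv ℝ F (complexCoord P Q y) Complex.I * pd 1 P y := fun y hy => by
    have h0 := (hdet y hy).ne'
    rw [hdetg y hy, hinv y hy, Fin.sum_univ_two, hfpd y hy, hfpd y hy]
    simp [← hg y hy]
    field_simp
    ring
  have hX1 : ∀ y ∈ U, √(g y).det * ∑ j, (g y)⁻¹ 1 j * pd j f y =
      fderiv ℝ F (complexCoord P Q y) Complex.I * pd 0 P y
        - fderiv ℝ F (complexCoord P Q y) 1 * pd 0 Q y := fun y hy => by
    have h0 := (hdet y hy).ne'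
    rw [hdetg y hy, hinv y hy, Fin.sum_univ_two, hfpd y hy, hfpd y hy]
    simp [← hg y hy]
    field_simp
    ring
  have hF' : ∀ u, ContDiffOn ℝ ∞ (fun w => fderiv ℝ F w u) W := contDiffOn_fderiv_apply hW hF
  have hPP := fun i j => hasPd_of_contDiffOn hU (contDiffOn_pd hU hP i) hx j
  have hQQ := fun i j => hasPd_of_contDiffOn hU (contDiffOn_pd hU hQ i) hx j
  have hd0 := (((hcomp (hF' 1) x hx 0).mul (hQQ 1 0)).sub
    ((hcomp (hF' Complex.I) x hx 0).mul (hPP 1 0))).2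
  have hd1 := (((hcomp (hF' Complex.I) x hx 1).mul (hPP 0 1)).sub
    ((hcomp (hF' 1) x hx 1).mul (hQQ 0 1))).2
  have h0 := (hdet x hx).ne'
  have key : laplacian g f x = fderiv ℝ (fun w => fderiv ℝ F w 1) (complexCoord P Q x) 1
      + fderiv ℝ (fun w => fderiv ℝ F w Complex.I) (complexCoord P Q x) Complex.I := by
    rw [laplacian, Fin.sum_univ_two, pd_congr hU hX0 hx, pd_congr hU hX1 hx, hd0, hd1, hdetg x hx,
      pd_pd_comm hU hP hx 0 1, pd_pd_comm hU hQ hx 0 1, one_div, inv_mul_eq_iff_eq_mul₀ h0]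
    ring
  rw [dzbar_dz_ofReal hW hF (hUW hx), key]
  ring

end FlatCoordinates

/-- Liouville's equation for `ψ = exp (-N)` in terms of `N`. -/
theorem liouville_exp_neg {W : Set ℂ} (hW : IsOpen W) {N : ℂ → ℝ} (hN : ContDiffOn ℝ ∞ N W) {z : ℂ}
    (hz : z ∈ W) :
    (Real.exp (-N z) : ℂ) * dzbar (dz fun w => (Real.exp (-N w) : ℂ)) z
      - dz (fun w => (Real.exp (-N w) : ℂ)) z * conj (dz (fun w => (Real.exp (-N w) : ℂ)) z) =
    -(Real.exp (-(2 * N z)) : ℂ) * dzbar (dz fun w => (N w : ℂ)) z := by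
  have hV : ContDiffOn ℝ ∞ (fun w => (N w : ℂ)) W := Complex.ofRealCLM.contDiff.comp_contDiffOn hN
  set a := dz fun w => (N w : ℂ)
  have ha : ContDiffOn ℝ ∞ a W := contDiffOn_dz hW hV
  have hψ : ∀ w ∈ W, HasWirt (fun w => (Real.exp (-N w) : ℂ)) (-a w * Real.exp (-N w))
      (-conj (a w) * Real.exp (-N w)) w := fun w hw => by
    have h1 : HasFDerivAt (fun w => (N w : ℂ)) (wirt (a w) (conj (a w))) w :=
      (hasWirt_of_contDiffOn hW hV hw).congr_val rfl
        (dzbar_ofReal ((hN.contDiffAt (hW.mem_nhds hw)).differentiableAt (by simp)))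
    have h2 := ((Complex.hasDerivAt_exp (-(N w : ℂ))).hasFDerivAt.restrictScalars ℝ).comp w h1.neg
    have h3 : HasWirt (fun w => Complex.exp (-(N w : ℂ))) (-a w * Complex.exp (-(N w : ℂ)))
        (-conj (a w) * Complex.exp (-(N w : ℂ))) w := h2.congr_fderiv (by ext; simp; ring)
    simpa only [Complex.ofReal_exp, Complex.ofReal_neg] using h3
  have hdz : ∀ w ∈ W, dz (fun w => (Real.exp (-N w) : ℂ)) w = -a w * Real.exp (-N w) :=
    fun w hw => ((hψ w hw).differentiableAt.hasWirt.unique (hψ w hw)).1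
  have h1 := ((hasWirt_const 0).sub (hasWirt_of_contDiffOn hW ha hz)).mul (hψ z hz)
  have h2 : HasWirt (dz fun w => (Real.exp (-N w) : ℂ)) _ _ z :=
    h1.congr (Filter.eventually_of_mem (hW.mem_nhds hz) fun w hw => by
      rw [hdz w hw]; simp only [zero_sub])
  rw [(h2.differentiableAt.hasWirt.unique h2).2, hdz z hz,
    show Real.exp (-(2 * N z)) = Real.exp (-N z) * Real.exp (-N z) by
      rw [← Real.exp_add]; congr 1; ring]
  simp only [map_mul, map_neg, Complex.conj_ofReal, Complex.ofReal_mul]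
  ring

/-- The flat metric underlying leaf-like data has local flat coordinates `P`, `Q`, in which
`n = (1/2) log ℓ` satisfies `Δ n = 2 ℓ`. -/
theorem IsLeafLikeData.exists_flat_coordinates {Ω : Set (Coord 2)} {g₀ : MatField 2}
    {ℓ h : Coord 2 → ℝ} (hdata : IsLeafLikeData Ω g₀ ℓ h) {p : Coord 2} (hp : p ∈ Ω) :
    ∃ (B : Set (Coord 2)) (P Q : Coord 2 → ℝ) (g : MatField 2), IsOpen B ∧ p ∈ B ∧ B ⊆ Ω ∧
      ContDiffOn ℝ ∞ P B ∧ ContDiffOn ℝ ∞ Q B ∧ ∀ x ∈ B, g₀ x = g x ∧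
      (∀ a b, pd a P x * pd b P x + pd a Q x * pd b Q x = g x a b) ∧
      0 < pd 0 P x * pd 1 Q x - pd 1 P x * pd 0 Q x ∧
      laplacian g (fun y => Real.log (ℓ y) / 2) x = 2 * ℓ x := by
  obtain ⟨ε, hε, hB⟩ := Metric.isOpen_iff.1 hdata.isOpen p hp
  set B := Metric.ball p ε
  have hBo : IsOpen B := Metric.isOpen_ball
  have hg₀ : IsMetricOn g₀ B := ⟨fun i j => (hdata.metric.smooth i j).mono hB,
    fun x hx => hdata.metric.posDef x (hB hx)⟩
  obtain ⟨α, β, γ, hα, hβ, hγ, hα0, hγ0, hg⟩ := exists_triMetric hg₀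
  have hK : ∀ x ∈ B, gaussCurvature (triMetric α β γ) x = 0 := fun x hx => by
    rw [← gaussCurvature_congr hBo hg hx]
    simp [gaussCurvature, hdata.flat x (hB hx)]
  obtain ⟨P, Q, hP, hQ, hPQ⟩ :=
    LeafLike.exists_flat_coordinates hBo (convex_ball p ε) hα hβ hγ hα0 hγ0 hK
  have hn : ContDiffOn ℝ ∞ (fun y => Real.log (ℓ y) / 2) B :=
    ((hdata.smooth_l.mono hB).log fun x hx => (hdata.pos x (hB hx)).ne').div_const 2
  have hexp : ∀ x ∈ B, Real.exp (2 * (Real.log (ℓ x) / 2)) = ℓ x := fun x hx => by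
    rw [mul_div_cancel₀ _ (two_ne_zero' ℝ), Real.exp_log (hdata.pos x (hB hx))]
  refine ⟨B, P, Q, triMetric α β γ, hBo, Metric.mem_ball_self hε, hB, hP, hQ, fun x hx =>
    ⟨hg x hx, (hPQ x hx).1, (hPQ x hx).2, ?_⟩⟩
  have h1 := gaussCurvature_conformal hBo hα hβ hγ hα0 hγ0 hn hx
  have h2 : gaussCurvature (fun y => Real.exp (2 * (Real.log (ℓ y) / 2)) • triMetric α β γ y) x =
      -2 := by
    rw [← hdata.hyperbolic x (hB hx)]
    exact gaussCurvature_congr hBo (fun y hy => by rw [hexp y hy, hg y hy]) hx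
  rw [h2, hK x hx, hexp x hx] at h1
  linarith

/-- Around every point, a leaf-like metric is the pull-back of `Im T |dw|²` by a diffeomorphism
onto a disc, for some holomorphic `T` on the disc. -/
theorem IsLeafLikeData.exists_holomorphic {Ω : Set (Coord 2)} {g₀ : MatField 2}
    {ℓ h : Coord 2 → ℝ} (hdata : IsLeafLikeData Ω g₀ ℓ h) {p : Coord 2} (hp : p ∈ Ω) :
    ∃ (U : Set (Coord 2)) (D : Set ℂ) (T : ℂ → ℂ) (f : Coord 2 → ℂ), IsOpen U ∧ p ∈ U ∧ U ⊆ Ω ∧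
      IsOpen D ∧ Convex ℝ D ∧ D.Nonempty ∧ DifferentiableOn ℂ T D ∧ (∀ z ∈ D, 0 < (T z).im) ∧
      ContDiffOn ℝ ∞ f U ∧ Set.BijOn f U D ∧ ∀ x ∈ U, ∀ a b, (T (f x)).im *
        (pd a (fun y => (f y).re) x * pd b (fun y => (f y).re) x
          + pd a (fun y => (f y).im) x * pd b (fun y => (f y).im) x) =
        leafLikeMetric g₀ ℓ h x a b := by
  obtain ⟨B, P, Q, g, hBo, hpB, hBΩ, hP, hQ, hflat⟩ := hdata.exists_flat_coordinates hp
  have hd : ∀ {f : Coord 2 → ℝ}, ContDiffOn ℝ ∞ f B → ∀ y ∈ B, DifferentiableAt ℝ f y :=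
    fun hf y hy => (hf.contDiffAt (hBo.mem_nhds hy)).differentiableAt (by simp)
  -- the chart `z = P + i Q`
  obtain ⟨e₁, hpe₁, he₁B, he₁, he₁s⟩ := exists_openPartialHomeomorph hBo
    (contDiffOn_complexCoord hP hQ) (fun x hx => complexCoord_deriv_equiv (hd hP x hx) (hd hQ x hx)
      (hflat x hx).2.2.1.ne') hpB
  have hWo : IsOpen e₁.target := e₁.open_target
  have hsymm : Set.MapsTo e₁.symm e₁.target B := fun z hz => he₁B (e₁.map_target hz)
  have hn : ContDiffOn ℝ ∞ (fun y => Real.log (ℓ y) / 2) B :=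
    ((hdata.smooth_l.mono hBΩ).log fun x hx => (hdata.pos x (hBΩ hx)).ne').div_const 2
  have hN : ContDiffOn ℝ ∞ (fun z => Real.log (ℓ (e₁.symm z)) / 2) e₁.target := hn.comp he₁s hsymm
  have hH : ContDiffOn ℝ ∞ (fun z => h (e₁.symm z)) e₁.target :=
    (hdata.smooth_h.mono hBΩ).comp he₁s hsymm
  have hmaps : Set.MapsTo (complexCoord P Q) e₁.source e₁.target := he₁ ▸ e₁.mapsTo
  have hlinv : ∀ x ∈ e₁.source, e₁.symm (complexCoord P Q x) = x := fun x hx => by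
    rw [← he₁]; exact e₁.left_inv hx
  have hrinv : ∀ z ∈ e₁.target, complexCoord P Q (e₁.symm z) = z := fun z hz => by
    rw [← he₁]; exact e₁.right_inv hz
  have hΔN : ∀ z ∈ e₁.target, dzbar (dz fun w => ((Real.log (ℓ (e₁.symm w)) / 2 : ℝ) : ℂ)) z =
      ℓ (e₁.symm z) / 2 := fun z hz => by
    have hx := e₁.map_target hz
    have h1 := laplacian_eq_dzbar_dz e₁.open_source (hP.mono he₁B) (hQ.mono he₁B)
      (fun x hx => (hflat x (he₁B hx)).2.1) (fun x hx => (hflat x (he₁B hx)).2.2.1) hWo hN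
      (f := fun y => Real.log (ℓ y) / 2) hmaps (fun x hx => by simp only [hlinv x hx]) hx
    rw [(hflat _ (he₁B hx)).2.2.2, hrinv z hz] at h1
    push_cast at h1 ⊢
    linear_combination -h1 / 4
  have hΔH : ∀ z ∈ e₁.target, dzbar (dz fun w => (h (e₁.symm w) : ℂ)) z = 0 := fun z hz => by
    have hx := e₁.map_target hz
    have h1 := laplacian_eq_dzbar_dz e₁.open_source (hP.mono he₁B) (hQ.mono he₁B) (g := g₀)
      (fun x hx a b => by rw [(hflat x (he₁B hx)).1]; exact (hflat x (he₁B hx)).2.1 a b)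
      (fun x hx => (hflat x (he₁B hx)).2.2.1) hWo hH
      (f := h) hmaps (fun x hx => by simp only [hlinv x hx]) hx
    rw [hdata.harmonic _ (hBΩ (he₁B hx)), hrinv z hz] at h1
    push_cast at h1
    linear_combination -h1 / 4
  have hexp : ∀ x ∈ B, Real.exp (2 * (Real.log (ℓ x) / 2)) = ℓ x := fun x hx => by
    rw [mul_div_cancel₀ _ (two_ne_zero' ℝ), Real.exp_log (hdata.pos x (hBΩ hx))]
  -- `ψ = ℓ ^ (-1/2)` is a solution of Liouville's equation
  obtain ⟨r, hr, hrW, y, τ, hy, hτ, hyτ⟩ := exists_liouville_representation hWo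
    (ψ := fun z => Real.exp (-(Real.log (ℓ (e₁.symm z)) / 2))) hN.neg.exp
    (fun z _ => Real.exp_pos _) (fun z hz => by
      have hx := hsymm hz
      rw [liouville_exp_neg hWo hN hz, hΔN z hz, Real.exp_neg, hexp _ hx]
      have : (ℓ (e₁.symm z) : ℂ) ≠ 0 := Complex.ofReal_ne_zero.2 (hdata.pos _ (hBΩ hx)).ne'
      push_cast
      field_simp) (e₁.map_source hpe₁)
  set z₀ := e₁ p
  set C := Metric.ball z₀ r
  have hCo : IsOpen C := Metric.isOpen_ball
  have hCc : Convex ℝ C := convex_ball z₀ r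
  obtain ⟨F, hF, hFH⟩ := exists_re_eq_of_harmonic hCo hCc (hH.mono hrW)
    fun z hz => hΔH z (hrW hz)
  -- the coordinate `w` with `|dw|² = |y|² e^{-h} |dz|²`
  have hφ : DifferentiableOn ℂ (fun z => y z * Complex.exp (-F z / 2)) C :=
    hy.mul ((hF.neg.div_const 2).cexp)
  have hφ0 : ∀ z ∈ C, y z * Complex.exp (-F z / 2) ≠ 0 := fun z hz =>
    mul_ne_zero (hyτ z hz).1 (Complex.exp_ne_zero _)
  obtain ⟨ζ, hζ⟩ := hCc.exists_forall_hasDerivWithinAt hφ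
  have hζ' : ∀ z ∈ C, HasDerivAt ζ (y z * Complex.exp (-F z / 2)) z := fun z hz =>
    (hζ z hz).hasDerivAt (hCo.mem_nhds hz)
  have hζd : DifferentiableOn ℂ ζ C := fun z hz => (hζ z hz).differentiableWithinAt
  obtain ⟨e₂, hze₂, he₂C, he₂, he₂s⟩ := exists_openPartialHomeomorph (𝕜 := ℂ) hCo
    (hζd.contDiffOn hCo) (fun z hz => ⟨_, (hζ' z hz).hasFDerivAt_equiv (hφ0 z hz)⟩)
    (Metric.mem_ball_self hr)
  let e := e₁.trans e₂
  have hpe : p ∈ e.source := by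
    rw [OpenPartialHomeomorph.trans_source]
    exact ⟨hpe₁, hze₂⟩
  have hes : ∀ x ∈ e.source, x ∈ e₁.source ∧ complexCoord P Q x ∈ e₂.source := fun x hx => by
    rw [OpenPartialHomeomorph.trans_source, he₁] at hx
    exact hx
  have he : ∀ x, e x = ζ (complexCoord P Q x) := fun x => by
    rw [← he₂, ← he₁]; rfl
  obtain ⟨ε, hε, hD⟩ := Metric.isOpen_iff.1 e.open_target (e p) (e.map_source hpe)
  have hDe₂ : Metric.ball (e p) ε ⊆ e₂.target := fun w hw => by
    have h1 := e.map_target (hD hw)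
    have h2 : e (e.symm w) = w := e.right_inv (hD hw)
    rw [he] at h2
    rw [← h2, ← he₂]
    exact e₂.map_source (hes _ h1).2
  refine ⟨e.source ∩ e ⁻¹' Metric.ball (e p) ε, Metric.ball (e p) ε, fun w => τ (e₂.symm w), e,
    e.isOpen_inter_preimage Metric.isOpen_ball, ⟨hpe, Metric.mem_ball_self hε⟩,
    fun x hx => hBΩ (he₁B (hes x hx.1).1), Metric.isOpen_ball, convex_ball _ _,
    ⟨_, Metric.mem_ball_self hε⟩, ?_, ?_, ?_, ?_, ?_⟩
  · exact hτ.comp ((he₂s.differentiableOn (by simp)).mono hDe₂)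
      fun w hw => he₂C (e₂.map_target (hDe₂ hw))
  · exact fun w hw => (hyτ _ (he₂C (e₂.map_target (hDe₂ hw)))).2.1
  · have h1 : ContDiffOn ℝ ∞ ζ C := (hζd.contDiffOn hCo).restrict_scalars ℝ
    refine (h1.comp ((contDiffOn_complexCoord hP hQ).mono fun x hx => he₁B (hes x hx).1)
      fun x hx => he₂C (hes x hx).2).mono Set.inter_subset_left |>.congr fun x _ => he x
  · refine ⟨fun x hx => hx.2, e.injOn.mono Set.inter_subset_left, fun w hw =>
      ⟨e.symm w, ⟨e.map_target (hD hw), ?_⟩, e.right_inv (hD hw)⟩⟩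
    rw [Set.mem_preimage, e.right_inv (hD hw)]
    exact hw
  · rintro x ⟨hx, -⟩ a b
    obtain ⟨hx₁, hx₂⟩ := hes x hx
    have hxB := he₁B hx₁
    set z := complexCoord P Q x
    have hzC : z ∈ C := he₂C hx₂
    have hT : e₂.symm (e x) = z := by
      rw [he, ← he₂]
      exact e₂.left_inv hx₂
    have hζz := (hζ' z hzC).hasFDerivAt.restrictScalars ℝ
    have hre : HasFDerivAt (fun w => (ζ w).re) _ z := Complex.reCLM.hasFDerivAt.comp z hζz
    have him : HasFDerivAt (fun w => (ζ w).im) _ z := Complex.imCLM.hasFDerivAt.comp z hζz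
    have hpre : ∀ i, pd i (fun x => (e x).re) x = (y z * Complex.exp (-F z / 2)).re * pd i P x
        - (y z * Complex.exp (-F z / 2)).im * pd i Q x := fun i => by
      simp only [he]
      refine (hasPd_comp_complexCoord (hd hP x hxB) (hd hQ x hxB) hre.differentiableAt i).2.trans ?_
      rw [hre.fderiv]
      simp
      ring
    have hpim : ∀ i, pd i (fun x => (e x).im) x = (y z * Complex.exp (-F z / 2)).im * pd i P x
        + (y z * Complex.exp (-F z / 2)).re * pd i Q x := fun i => by
      simp only [he]
      refine (hasPd_comp_complexCoord (hd hP x hxB) (hd hQ x hxB) him.differentiableAt i).2.trans ?_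
      rw [him.fderiv]
      simp
    have hnorm : Complex.normSq (y z * Complex.exp (-F z / 2)) =
        Complex.normSq (y z) * Real.exp (-h x) := by
      have h1 : (F z).re = h x := by rw [hFH z hzC, hlinv x hx₁]
      rw [map_mul, Complex.normSq_eq_norm_sq (Complex.exp _), Complex.norm_exp, ← Real.exp_nat_mul,
        ← h1]
      congr 2
      simp
      ring
    have hψ : ℓ x ^ (-(1 / 2) : ℝ) = (τ z).im * Complex.normSq (y z) := by
      have h1 := (hyτ z hzC).2.2
      simp only [z, hlinv x hx₁] at h1
      rw [← h1, Real.rpow_def_of_pos (hdata.pos x (hBΩ hxB))]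
      congr 1
      ring
    have hgx := (hflat x hxB).2.1 a b
    rw [Complex.normSq_apply (y z * _)] at hnorm
    simp only [hT, hpre, hpim, leafLikeMetric, Matrix.smul_apply, smul_eq_mul, hψ,
      (hflat x hxB).1, ← hgx]
    linear_combination ((τ z).im * (pd a P x * pd b P x + pd a Q x * pd b Q x)) * hnorm

end LeafLike

end

theorem theorem13p1 (Ω : Set (LeafLike.Coord 2)) (g₀ : LeafLike.MatField 2)
    (ℓ h : LeafLike.Coord 2 → ℝ) (hdata : LeafLike.IsLeafLikeData Ω g₀ ℓ h)
    (p : LeafLike.Coord 2) (hp : p ∈ Ω) :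
    ∃ U : Set (LeafLike.Coord 2), IsOpen U ∧ p ∈ U ∧ U ⊆ Ω ∧
    ∃ (M : Set (LeafLike.Coord 4)) (g J : LeafLike.MatField 4)
      (𝓛 : Set (Set (LeafLike.Coord 4))),
      IsOpen M ∧ IsConnected M ∧
      LeafLike.IsKahlerOn g J M ∧
      LeafLike.IsRicciFlatOn g M ∧
      LeafLike.IsFoliationOn 2 2 M 𝓛 ∧
      (∀ L ∈ 𝓛, LeafLike.IsTotallyGeodesic 2 g L) ∧
      (∀ L ∈ 𝓛, LeafLike.IsIsometricLeaf g L (LeafLike.leafLikeMetric g₀ ℓ h) U) ∧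
      2 ≤ Module.rank ℝ (LeafLike.killingFields g M) := by
  obtain ⟨U, D, T, f, hU, hpU, hUΩ, hD, hc, hne, hT, hpos, hf, hbij, hγ⟩ :=
    hdata.exists_holomorphic hp
  exact ⟨U, hU, hpU, hUΩ,
    LeafLike.exists_foliated_ricciFlat_kahler hD hc hne hT hpos hf hbij hγ⟩
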